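/- Let $k\ge 1$, let $S_k$ be the set of symmetric positive definite real $k\times k$ matrices and $M_k$ the set of all real $k\times k$ matrices. For $\mathcal V=(\mu,\Sigma,\nu)\in\mathbb R^k\times S_k\times(0,\infty)$ let $$f_{\mathcal V}(x)=\frac{\Gamma(\frac{\nu+k}{2})}{(\pi\nu)^{k/2}\,\Gamma(\frac{\nu}{2})}\,|\Sigma|^{-1/2}\Bigl(1+\tfrac1\nu (x-\mu)'\Sigma^{-1}(x-\mu)\Bigr)^{-(\nu+k)/2},\qquad x\in\mathbb R^k,$$ be the $k$-variate Student $t$ density, and let $\mathrm P^{(n)}_{\mathcal V}$ be the joint law of $n$ i.i.d. observations $X_1,\dots,X_n$ with density $f_{\mathcal V}$. For $A\in M_k$ let $\mathrm{vech}(A)\in\mathbb R^{k(k+1)/2}$ be the vector of the entries of $A$ on and above the diagonal. Let $\mathcal L_{\mathcal V}(x)$ be the score vector, i.e. the gradient of $\log f_{\mu,\Sigma,\nu}(x)$ with respect to $(\mu',(\mathrm{vech}\,\Sigma)',\nu)'$, let $$\Delta^{(n)}(\mathcal V)=n^{-1/2}\sum_{i=1}^n\mathcal L_{\mathcal V}(X_i),$$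 and let the Fisher information matrix $\Gamma(\mathcal V)$ be the covariance matrix of $\mathcal L_{\mathcal V}(X_1)$ under $\mathrm P^{(1)}_{\mathcal V}$. Theorem. For every $\mu\in\mathbb R^k$, $\Sigma\in S_k$ and $\nu>0$, the Student $t$ family is uniformly locally asymptotically normal (ULAN) at $\mathcal V=(\mu,\Sigma,\nu)$ with central sequence $\Delta^{(n)}(\mathcal V)$ and information matrix $\Gamma(\mathcal V)$. Precisely: $\Gamma(\mathcal V)$ is finite (the score is square integrable), symmetric and non-singular (hence positive definite), and for every sequence $\mathcal V^{(n)}=(\mu^{(n)},\Sigma^{(n)},\nu^{(n)})\in\mathbb R^k\times S_k\times(0,\infty)$ with $\mathcal V^{(n)}=\mathcal V+O(n^{-1/2})$ and every bounded sequence $\tau^{(n)}=(\tau^{(n)}_1,\tau^{(n)}_2,\tau^{(n)}_3)\in\mathbb R^k\times M_k\times\mathbb R$ such that $\Sigma^{(n)}+n^{-1/2}\tau^{(n)}_2\in S_k$ and $\nu^{(n)}+n^{-1/2}\tau^{(n)}_3>0$ for all $n$, writing $\mathcal T^{(n)}=((\tau^{(n)}_1)',(\mathrm{vech}\,\tau^{(n)}_2)',\tau^{(n)}_3)'$,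 the law $\mathrm P^{(n)}_{\mathcal V^{(n)}+n^{-1/2}\tau^{(n)}}$ is absolutely continuous with respect to $\mathrm P^{(n)}_{\mathcal V^{(n)}}$, $$\log\frac{\mathrm d\mathrm P^{(n)}_{\mathcal V^{(n)}+n^{-1/2}\tau^{(n)}}}{\mathrm d\mathrm P^{(n)}_{\mathcal V^{(n)}}}=(\mathcal T^{(n)})'\Delta^{(n)}(\mathcal V^{(n)})-\tfrac12(\mathcal T^{(n)})'\,\Gamma(\mathcal V)\,\mathcal T^{(n)}+o_{\mathrm P}(1),$$ and $$\Delta^{(n)}(\mathcal V^{(n)})\xrightarrow{\ \mathcal L\ }\mathcal N_{k+k(k+1)/2+1}\bigl(0,\Gamma(\mathcal V)\bigr),$$ both under $\mathrm P^{(n)}_{\mathcal V^{(n)}}$ as $n\to\infty$. -/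

import Mathlib

open MeasureTheory ProbabilityTheory Filter Topology Asymptotics
open scoped Matrix

namespace StudentT

noncomputable section

/-- Triples `(location, scatter, tail)` in `ℝ^k × M_k × ℝ`, with componentwise operations. -/
abbrev Triple (k : ℕ) : Type :=
  EuclideanSpace ℝ (Fin k) × Matrix (Fin k) (Fin k) ℝ × ℝ

/-- The parameter space: scatter symmetric positive definite, tail weight positive. -/
def paramSpace (k : ℕ) : Set (Triple k) :=
  {V | V.2.1.PosDef ∧ 0 < V.2.2}

/-- Positions on or above the diagonal of a `k × k` matrix, the index set of `vech`. -/
abbrev UpperIdx (k : ℕ) : Type := {p : Fin k × Fin k // p.1 ≤ p.2}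

/-- Index set of the coordinates `(μ, vech Σ, ν)`; it has `k + k (k + 1) / 2 + 1` elements. -/
abbrev CoordIdx (k : ℕ) : Type := Fin k ⊕ UpperIdx k ⊕ Unit

/-- The entries of a matrix on and above the diagonal. -/
def vech {k : ℕ} (A : Matrix (Fin k) (Fin k) ℝ) : UpperIdx k → ℝ :=
  fun p => A p.1.1 p.1.2

/-- The symmetric matrix with prescribed entries on and above the diagonal. -/
def unvech {k : ℕ} (v : UpperIdx k → ℝ) : Matrix (Fin k) (Fin k) ℝ :=
  Matrix.of fun i j => v ⟨(min i j, max i j), min_le_max⟩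

/-- The coordinate vector `(μ', (vech Σ)', ν)'` of a triple. -/
def coords {k : ℕ} (V : Triple k) : EuclideanSpace ℝ (CoordIdx k) :=
  WithLp.toLp 2 (Sum.elim (fun i => V.1 i) (Sum.elim (vech V.2.1) fun _ => V.2.2))

/-- The triple (with symmetric matrix component) that has a given coordinate vector. -/
def ofCoords {k : ℕ} (θ : EuclideanSpace ℝ (CoordIdx k)) : Triple k :=
  (WithLp.toLp 2 fun i => θ (Sum.inl i), unvech fun p => θ (Sum.inr (Sum.inl p)),
    θ (Sum.inr (Sum.inr ())))

/-- The normalizing constant `Γ((ν + k) / 2) / ((π ν)^(k / 2) Γ(ν / 2))`. -/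
def normConst (k : ℕ) (ν : ℝ) : ℝ :=
  Real.Gamma ((ν + k) / 2) / ((Real.pi * ν) ^ ((k : ℝ) / 2) * Real.Gamma (ν / 2))

/-- The squared Mahalanobis norm
`‖Σ^(-1/2) (x - μ)‖ ^ 2 = (x - μ)' Σ⁻¹ (x - μ)`. -/
def mahalanobisSq {k : ℕ} (μ : EuclideanSpace ℝ (Fin k)) (S : Matrix (Fin k) (Fin k) ℝ)
    (x : EuclideanSpace ℝ (Fin k)) : ℝ :=
  (x - μ).ofLp ⬝ᵥ (S⁻¹ *ᵥ (x - μ).ofLp)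

/-- The density of the `k`-dimensional Student `t` distribution with parameter `V = (μ, Σ, ν)`. -/
def density {k : ℕ} (V : Triple k) (x : EuclideanSpace ℝ (Fin k)) : ℝ :=
  normConst k V.2.2 * V.2.1.det ^ (-(1 / 2 : ℝ)) *
    (1 + mahalanobisSq V.1 V.2.1 x / V.2.2) ^ (-((V.2.2 + k) / 2))

/-- The `k`-dimensional Student `t` distribution. -/
def law {k : ℕ} (V : Triple k) : Measure (EuclideanSpace ℝ (Fin k)) :=
  volume.withDensity fun x => ENNReal.ofReal (density V x)

/-- The joint distribution of `n` i.i.d. Student `t` observations. -/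
def lawN {k : ℕ} (n : ℕ) (V : Triple k) : Measure (Fin n → EuclideanSpace ℝ (Fin k)) :=
  Measure.pi fun _ => law V

/-- The score vector: the gradient of the log-density with respect to `(μ, vech Σ, ν)`. -/
def score {k : ℕ} (V : Triple k) (x : EuclideanSpace ℝ (Fin k)) : EuclideanSpace ℝ (CoordIdx k) :=
  gradient (fun θ => Real.log (density (ofCoords θ) x)) (coords V)

/-- The Fisher information matrix: the covariance matrix of the score vector. -/
def fisherInfo {k : ℕ} (V : Triple k) : Matrix (CoordIdx k) (CoordIdx k) ℝ :=
  Matrix.of fun i j => cov[fun x => score V x i, fun x => score V x j; law V]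

/-- The central sequence `n^(-1/2) ∑ᵢ score V (Xᵢ)`. -/
def centralSeq {k : ℕ} (n : ℕ) (V : Triple k) (X : Fin n → EuclideanSpace ℝ (Fin k)) :
    EuclideanSpace ℝ (CoordIdx k) :=
  (√(n : ℝ))⁻¹ • ∑ i, score V (X i)

/-- `R n = o_P(1)` under the measures `P n`, on sample spaces that may depend on `n`. -/
def IsLittleOP {Ω : ℕ → Type*} [∀ n, MeasurableSpace (Ω n)] (P : ∀ n, Measure (Ω n))
    (R : ∀ n, Ω n → ℝ) : Prop :=
  ∀ ε : ℝ, 0 < ε → Tendsto (fun n => P n {ω | ε ≤ |R n ω|}) atTop (𝓝 0)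

end

end StudentT

/-
Near a given parameter the densities are dominated by a function `w` and the scores by a function
`b` with `b ^ 3 * w` integrable, while the Hessians of the log-density are bounded and continuous in
the parameter, uniformly in the observation. A second-order Taylor expansion then yields the
quadratic expansion of the log-likelihood ratio, with the law of large numbers for the Hessians and
the information identity producing the quadratic term, and a Lyapunov argument with third moments
gives the normality of the central sequence along varying parameters.

The domination comes from compactness. Adding `(ν + k) * log ‖(1, x)‖` to the log-density gives a
function that depends on `x` only through the radial projection of `(1, x)` onto the unit sphere of
`ℝ × ℝᵏ` and is smooth in the parameter and that projection. All its derivatives are hence bounded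
and equicontinuous on the sphere, and the score is a bounded function minus `log ‖(1, x)‖` times the
`ν`-coordinate.

The information matrix is non-singular because a direction along which the score vanishes has zero
`ν`-coordinate (the score would otherwise grow logarithmically in `x`), and what remains of the
score is a rational function of `x` whose numerator determines the `μ`- and `Σ`-coordinates.
-/

namespace StudentT

theorem tendsto_inv_sqrt_natCast : Tendsto (fun n : ℕ => (√(n : ℝ))⁻¹) atTop (𝓝 0) :=
  tendsto_inv_atTop_zero.comp (Real.tendsto_sqrt_atTop.comp tendsto_natCast_atTop_atTop)

namespace IsLittleOP

variable {Ω : ℕ → Type*} [∀ n, MeasurableSpace (Ω n)] {P : ∀ n, Measure (Ω n)}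
  {R S : ∀ n, Ω n → ℝ}

theorem add (hR : IsLittleOP P R) (hS : IsLittleOP P S) :
    IsLittleOP P fun n ω => R n ω + S n ω := by
  intro ε hε
  have h := (hR (ε / 2) (half_pos hε)).add (hS (ε / 2) (half_pos hε))
  rw [add_zero] at h
  refine tendsto_of_tendsto_of_tendsto_of_le_of_le tendsto_const_nhds h
    (fun _ => zero_le) fun n => (measure_mono fun ω hω => ?_).trans (measure_union_le _ _)
  simp only [Set.mem_ofPred_eq, Set.mem_union] at hω ⊢
  by_contra! hcon
  linarith [abs_add_le (R n ω) (S n ω), hcon.1, hcon.2]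

theorem of_abs_le (hS : IsLittleOP P S) (h : ∀ᶠ n in atTop, ∀ᵐ ω ∂P n, |R n ω| ≤ |S n ω|) :
    IsLittleOP P R := by
  intro ε hε
  refine tendsto_of_tendsto_of_tendsto_of_le_of_le' tendsto_const_nhds (hS ε hε)
    (Eventually.of_forall fun _ => zero_le) ?_
  filter_upwards [h] with n hn
  refine measure_mono_ae ?_
  filter_upwards [hn] with ω hω hεR using le_trans hεR hω

theorem of_forall_eventually_abs_le (h : ∀ ε > 0, ∀ᶠ n in atTop, ∀ ω, |R n ω| ≤ ε) :
    IsLittleOP P R := by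
  intro ε hε
  refine tendsto_const_nhds.congr' ?_
  filter_upwards [h (ε / 2) (half_pos hε)] with n hn
  have hempty : {ω | ε ≤ |R n ω|} = ∅ :=
    Set.eq_empty_iff_forall_notMem.2 fun ω hω =>
      absurd (le_trans hω (hn ω)) (not_le.2 (half_lt_self hε))
  rw [hempty, measure_empty]

theorem mul_of_abs_le (hS : IsLittleOP P S) {c : ℕ → ℝ} {C : ℝ} (hc : ∀ n, |c n| ≤ C) :
    IsLittleOP P fun n ω => c n * S n ω := by
  have hC : 0 ≤ C := (abs_nonneg _).trans (hc 0)
  intro ε hε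
  refine tendsto_of_tendsto_of_tendsto_of_le_of_le tendsto_const_nhds
    (hS (ε / (C + 1)) (by positivity)) (fun _ => zero_le) fun n => measure_mono fun ω hω => ?_
  simp only [Set.mem_ofPred_eq, abs_mul] at hω ⊢
  rw [div_le_iff₀ (by positivity)]
  calc ε ≤ |c n| * |S n ω| := hω
    _ ≤ (C + 1) * |S n ω| := by gcongr; linarith [hc n]
    _ = |S n ω| * (C + 1) := mul_comm _ _

theorem sum {ι : Type*} (s : Finset ι) {S : ι → ∀ n, Ω n → ℝ}
    (hS : ∀ i ∈ s, IsLittleOP P (S i)) : IsLittleOP P fun n ω => ∑ i ∈ s, S i n ω := by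
  classical
  induction s using Finset.induction_on with
  | empty => exact of_forall_eventually_abs_le fun ε hε => by simp [hε.le]
  | insert a s ha ih =>
    simp only [Finset.sum_insert ha]
    exact (hS a (Finset.mem_insert_self _ _)).add
      (ih fun i hi => hS i (Finset.mem_insert_of_mem hi))

end IsLittleOP

section LogDensity

variable {X : Type*} [MeasurableSpace X] {μ : Measure X} {u v : X → ℝ}

/-- The measure with density `exp ∘ u` with respect to `μ`. Unlike `Measure.tilted`, it is not
normalized. -/
noncomputable def withLogDensity (μ : Measure X) (u : X → ℝ) : Measure X :=
  μ.withDensity fun x => ENNReal.ofReal (Real.exp (u x))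

theorem withLogDensity_withLogDensity (hu : Measurable u) (hv : Measurable v) :
    withLogDensity (withLogDensity μ u) v = withLogDensity μ fun x => u x + v x := by
  rw [withLogDensity, withLogDensity, withLogDensity,
    ← withDensity_mul μ (by fun_prop) (by fun_prop)]
  congr 1 with x
  rw [Pi.mul_apply, ← ENNReal.ofReal_mul (Real.exp_pos _).le, Real.exp_add]

theorem withLogDensity_absolutelyContinuous : withLogDensity μ u ≪ μ :=
  withDensity_absolutelyContinuous _ _

theorem absolutelyContinuous_withLogDensity (hu : Measurable u) : μ ≪ withLogDensity μ u :=
  withDensity_absolutelyContinuous' (by fun_prop)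
    (Eventually.of_forall fun x => by simpa using Real.exp_pos (u x))

theorem llr_withLogDensity [SigmaFinite μ] (hu : Measurable u) :
    llr (withLogDensity μ u) μ =ᵐ[μ] u := by
  filter_upwards [Measure.rnDeriv_withDensity μ
    (f := fun x => ENNReal.ofReal (Real.exp (u x))) (by fun_prop)] with x hx
  rw [llr, withLogDensity, hx, ENNReal.toReal_ofReal (Real.exp_pos _).le, Real.log_exp]

variable {F : Type*} [NormedAddCommGroup F] [NormedSpace ℝ F]

theorem integral_withLogDensity (hu : Measurable u) (g : X → F) :
    ∫ x, g x ∂withLogDensity μ u = ∫ x, Real.exp (u x) • g x ∂μ := by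
  rw [withLogDensity, integral_withDensity_eq_integral_toReal_smul (by fun_prop)
    (Eventually.of_forall fun _ => ENNReal.ofReal_lt_top)]
  simp only [ENNReal.toReal_ofReal (Real.exp_pos _).le]

theorem integrable_withLogDensity_iff (hu : Measurable u) {g : X → F} :
    Integrable g (withLogDensity μ u) ↔ Integrable (fun x => Real.exp (u x) • g x) μ := by
  rw [withLogDensity, integrable_withDensity_iff_integrable_smul' (by fun_prop)
    (Eventually.of_forall fun _ => ENNReal.ofReal_lt_top)]
  simp only [ENNReal.toReal_ofReal (Real.exp_pos _).le]

end LogDensity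

section ProductMeasure

theorem indicator_univ_pi_prod {ι M : Type*} [Fintype ι] [CommMonoidWithZero M] {X : ι → Type*}
    (s : ∀ i, Set (X i)) (g : ∀ i, X i → M) (x : ∀ i, X i) :
    (Set.univ.pi s).indicator (fun x => ∏ i, g i (x i)) x = ∏ i, (s i).indicator (g i) (x i) := by
  by_cases hx : x ∈ Set.univ.pi s
  · rw [Set.indicator_of_mem hx]
    exact Finset.prod_congr rfl fun i _ => (Set.indicator_of_mem (hx i trivial) _).symm
  · obtain ⟨i, hi⟩ : ∃ i, x i ∉ s i := by simpa [Set.mem_univ_pi] using hx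
    rw [Set.indicator_of_notMem hx]
    exact (Finset.prod_eq_zero (Finset.mem_univ i) (Set.indicator_of_notMem hi _)).symm

variable {ι : Type*} [Fintype ι] {X : ι → Type*} [∀ i, MeasurableSpace (X i)]
  (P : ∀ i, Measure (X i)) [∀ i, IsProbabilityMeasure (P i)]

theorem lintegral_pi_prod {g : ∀ i, X i → ENNReal} (hg : ∀ i, Measurable (g i)) :
    ∫⁻ x, ∏ i, g i (x i) ∂Measure.pi P = ∏ i, ∫⁻ x, g i x ∂P i := by
  have hindep : iIndepFun (fun i (x : ∀ i, X i) => g i (x i)) (Measure.pi P) :=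
    iIndepFun_pi fun i => (hg i).aemeasurable
  rw [lintegral_prod_eq_prod_lintegral_of_indepFun Finset.univ _ hindep
    fun i => (hg i).comp (measurable_pi_apply i)]
  exact Finset.prod_congr rfl fun i _ => (measurePreserving_eval P i).lintegral_comp (hg i)

theorem pi_withDensity {g : ∀ i, X i → ENNReal} (hg : ∀ i, Measurable (g i))
    [∀ i, SigmaFinite ((P i).withDensity (g i))] :
    Measure.pi (fun i => (P i).withDensity (g i)) =
      (Measure.pi P).withDensity fun x => ∏ i, g i (x i) := by
  refine Measure.pi_eq fun s hs => ?_
  rw [withDensity_apply _ (MeasurableSet.univ_pi hs), ← lintegral_indicator (.univ_pi hs)]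
  simp_rw [indicator_univ_pi_prod]
  rw [lintegral_pi_prod P fun i => (hg i).indicator (hs i)]
  exact Finset.prod_congr rfl fun i _ => by
    rw [withDensity_apply _ (hs i), lintegral_indicator (hs i)]

theorem pi_withLogDensity {u : ∀ i, X i → ℝ} (hu : ∀ i, Measurable (u i)) :
    Measure.pi (fun i => withLogDensity (P i) (u i)) =
      withLogDensity (Measure.pi P) fun x => ∑ i, u i (x i) := by
  have : ∀ i, SigmaFinite ((P i).withDensity fun x => ENNReal.ofReal (Real.exp (u i x))) :=
    fun i => SigmaFinite.withDensity_ofReal _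
  simp only [withLogDensity]
  rw [pi_withDensity P fun i => by fun_prop]
  simp only [Real.exp_sum, ENNReal.ofReal_prod_of_nonneg fun _ _ => (Real.exp_pos _).le]

end ProductMeasure

section LawOfLargeNumbers

variable {X : Type*} [MeasurableSpace X]

theorem memLp_average_pi (P : Measure X) [IsProbabilityMeasure P] {g : X → ℝ} {p : ENNReal}
    (hg : MemLp g p P) (n : ℕ) :
    MemLp (fun x : Fin n → X => (n : ℝ)⁻¹ * ∑ i, g (x i)) p (Measure.pi fun _ => P) :=
  (memLp_finsetSum _ fun i _ =>
    hg.comp_measurePreserving (measurePreserving_eval (fun _ => P) i)).const_mul _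

theorem integral_average_pi (P : Measure X) [IsProbabilityMeasure P] {g : X → ℝ}
    (hg : Integrable g P) {n : ℕ} (hn : n ≠ 0) :
    ∫ x : Fin n → X, (n : ℝ)⁻¹ * ∑ i, g (x i) ∂Measure.pi (fun _ => P) = ∫ x, g x ∂P := by
  rw [integral_const_mul, integral_finsetSum _ fun i _ =>
    integrable_comp_eval (i := i) (μ := fun _ => P) hg]
  have heval (i : Fin n) :
      ∫ x : Fin n → X, g (x i) ∂Measure.pi (fun _ => P) = ∫ x, g x ∂P :=
    integral_comp_eval hg.aestronglyMeasurable
  simp only [heval, Finset.sum_const, Finset.card_univ, Fintype.card_fin, nsmul_eq_mul]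
  field_simp

theorem variance_average_pi (P : Measure X) [IsProbabilityMeasure P] {g : X → ℝ}
    (hg : MemLp g 2 P) (n : ℕ) :
    Var[fun x : Fin n → X => (n : ℝ)⁻¹ * ∑ i, g (x i); Measure.pi fun _ => P] =
      (n : ℝ)⁻¹ * Var[g; P] := by
  have hsum := variance_sum_pi (X := fun _ : Fin n => g) (μ := fun _ => P) fun _ => hg
  simp only [Finset.sum_fn, Finset.sum_const, Finset.card_univ, Fintype.card_fin,
    nsmul_eq_mul] at hsum
  rw [variance_const_mul, hsum]
  rcases eq_or_ne (n : ℝ) 0 with hn | hn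
  · simp [hn]
  · field_simp

theorem isLittleOP_average_sub (P : ℕ → Measure X) [∀ n, IsProbabilityMeasure (P n)]
    {g : X → ℝ} {v a : ℝ} (hg : ∀ n, MemLp g 2 (P n)) (hv : ∀ n, Var[g; P n] ≤ v)
    (ha : Tendsto (fun n => ∫ x, g x ∂P n) atTop (𝓝 a)) :
    IsLittleOP (fun n => Measure.pi fun _ : Fin n => P n)
      fun n x => (n : ℝ)⁻¹ * ∑ i, g (x i) - a := by
  intro ε hε
  have hmean : ∀ᶠ n in atTop, |∫ x, g x ∂P n - a| < ε / 2 := by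
    simpa [Real.dist_eq] using (Metric.tendsto_nhds.1 ha) (ε / 2) (half_pos hε)
  have hlim : Tendsto (fun n : ℕ => ENNReal.ofReal ((n : ℝ)⁻¹ * v / (ε / 2) ^ 2))
      atTop (𝓝 0) := by
    rw [← ENNReal.ofReal_zero]
    refine ENNReal.tendsto_ofReal ?_
    simpa [mul_div_assoc] using
      (tendsto_inv_atTop_nhds_zero_nat (𝕜 := ℝ)).mul_const (v / (ε / 2) ^ 2)
  refine tendsto_of_tendsto_of_tendsto_of_le_of_le' tendsto_const_nhds hlim
    (Eventually.of_forall fun _ => zero_le) ?_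
  filter_upwards [hmean, eventually_ne_atTop 0] with n hn hn0
  have hchebyshev := meas_ge_le_variance_div_sq (memLp_average_pi (P n) (hg n) n) (half_pos hε)
  rw [integral_average_pi (P n) ((hg n).integrable one_le_two) hn0,
    variance_average_pi (P n) (hg n)] at hchebyshev
  refine (measure_mono fun x (hx : ε ≤ |_ - a|) => ?_).trans
    (hchebyshev.trans (ENNReal.ofReal_le_ofReal (by gcongr; exact hv n)))
  rw [Set.mem_ofPred_eq]
  linarith [abs_sub_le ((n : ℝ)⁻¹ * ∑ i, g (x i)) (∫ x, g x ∂P n) a]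

end LawOfLargeNumbers

section CentralLimit

open Complex (I exp)

theorem norm_exp_I_mul_sub_one_sub_le (u : ℝ) : ‖exp (I * u) - 1 - I * u‖ ≤ |u| ^ 2 := by
  have hderiv (v : ℝ) : HasDerivAt (fun v : ℝ => exp (I * v) - 1 - I * v)
      (I * (exp (I * v) - 1)) v := by
    have hlin : HasDerivAt (fun v : ℝ => I * (v : ℂ)) I v := by
      simpa using (Complex.ofRealCLM.hasDerivAt (x := v)).const_mul I
    convert! (hlin.cexp.sub_const 1).sub hlin using 1
    ring
  have hbound : ∀ v ∈ Set.uIcc 0 u, ‖I * (exp (I * v) - 1)‖ ≤ |u| := fun v hv => by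
    rw [norm_mul, Complex.norm_I, one_mul]
    exact Real.norm_exp_I_mul_ofReal_sub_one_le.trans
      (by simpa using Set.abs_sub_left_of_mem_uIcc hv)
  simpa [sq] using (convex_uIcc 0 u).norm_image_sub_le_of_norm_hasDerivWithin_le
    (fun v _ => (hderiv v).hasDerivWithinAt) hbound Set.left_mem_uIcc Set.right_mem_uIcc

theorem norm_exp_I_mul_sub_taylor_two_le (u : ℝ) :
    ‖exp (I * u) - 1 - I * u + u ^ 2 / 2‖ ≤ |u| ^ 3 := by
  have hderiv (v : ℝ) : HasDerivAt (fun v : ℝ => exp (I * v) - 1 - I * v + v ^ 2 / 2)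
      (I * (exp (I * v) - 1 - I * v)) v := by
    have hid : HasDerivAt (fun v : ℝ => (v : ℂ)) 1 v := Complex.ofRealCLM.hasDerivAt (x := v)
    have hlin : HasDerivAt (fun v : ℝ => I * (v : ℂ)) I v := by simpa using hid.const_mul I
    convert! ((hlin.cexp.sub_const 1).sub hlin).add ((hid.pow 2).div_const 2) using 1
    linear_combination (-(v : ℂ)) * Complex.I_mul_I
  have hbound : ∀ v ∈ Set.uIcc 0 u, ‖I * (exp (I * v) - 1 - I * v)‖ ≤ |u| ^ 2 := fun v hv => by
    rw [norm_mul, Complex.norm_I, one_mul]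
    have hv : |v| ≤ |u| := by simpa using Set.abs_sub_left_of_mem_uIcc hv
    exact (norm_exp_I_mul_sub_one_sub_le v).trans (by gcongr)
  simpa [pow_succ] using (convex_uIcc 0 u).norm_image_sub_le_of_norm_hasDerivWithin_le
    (fun v _ => (hderiv v).hasDerivWithinAt) hbound Set.left_mem_uIcc Set.right_mem_uIcc

variable {X : Type*} [MeasurableSpace X]

theorem norm_integral_exp_I_mul_sub_le (P : Measure X) [IsProbabilityMeasure P] {Y : X → ℝ}
    (hY : MemLp Y 3 P) (hmean : ∫ x, Y x ∂P = 0) :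
    ‖∫ x, exp (I * Y x) ∂P - 1 + ((∫ x, Y x ^ 2 ∂P : ℝ) : ℂ) / 2‖ ≤ ∫ x, |Y x| ^ 3 ∂P := by
  have hint : Integrable Y P := hY.integrable (by norm_num)
  have hint2 : Integrable (fun x => Y x ^ 2) P := (hY.mono_exponent (by norm_num)).integrable_sq
  have hint3 : Integrable (fun x => |Y x| ^ 3) P := by
    simpa using hY.integrable_norm_pow (by norm_num)
  have hint_exp : Integrable (fun x => exp (I * Y x)) P :=
    Integrable.of_bound (by have := hint.1; fun_prop) 1
      (Eventually.of_forall fun x => (Complex.norm_exp_I_mul_ofReal _).le)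
  have htaylor : ∫ x, exp (I * Y x) ∂P - 1 + ((∫ x, Y x ^ 2 ∂P : ℝ) : ℂ) / 2 =
      ∫ x, (exp (I * Y x) - 1 - I * Y x + (Y x : ℂ) ^ 2 / 2) ∂P := by
    have hlin : ∫ x, I * (Y x : ℂ) ∂P = 0 := by
      rw [integral_const_mul, integral_complex_ofReal, hmean, Complex.ofReal_zero, mul_zero]
    have hquad : ∫ x, (Y x : ℂ) ^ 2 / 2 ∂P = ((∫ x, Y x ^ 2 ∂P : ℝ) : ℂ) / 2 := by
      simp_rw [integral_div, ← Complex.ofReal_pow, integral_complex_ofReal]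
    have hconst : Integrable (fun _ => (1 : ℂ)) P := integrable_const 1
    have hint_lin : Integrable (fun x => I * (Y x : ℂ)) P := hint.ofReal.const_mul I
    have hint_quad : Integrable (fun x => (Y x : ℂ) ^ 2 / 2) P := by
      simp_rw [← Complex.ofReal_pow]
      exact hint2.ofReal.div_const 2
    have hint_one : Integrable (fun x => exp (I * Y x) - 1) P := hint_exp.sub hconst
    have hint_two : Integrable (fun x => exp (I * Y x) - 1 - I * Y x) P := hint_one.sub hint_lin
    rw [integral_add hint_two hint_quad, integral_sub hint_one hint_lin,
      integral_sub hint_exp hconst, hlin, hquad]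
    simp
  rw [htaylor]
  exact norm_integral_le_of_norm_le hint3
    (Eventually.of_forall fun x => norm_exp_I_mul_sub_taylor_two_le _)

variable {E : Type*} [NormedAddCommGroup E] [InnerProductSpace ℝ E] [MeasurableSpace E]
  [BorelSpace E] [SecondCountableTopology E]

theorem measurable_smul_sum {n : ℕ} {s : X → E} (hs : Measurable s) (c : ℝ) :
    Measurable fun x : Fin n → X => c • ∑ i, s (x i) :=
  (Finset.measurable_fun_sum _ fun i _ => hs.comp (measurable_pi_apply i)).const_smul c

theorem charFun_map_smul_sum_pi (P : Measure X) [IsProbabilityMeasure P] {s : X → E}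
    (hs : Measurable s) (n : ℕ) (c : ℝ) (t : E) :
    charFun ((Measure.pi fun _ : Fin n => P).map fun x => c • ∑ i, s (x i)) t =
      charFun (P.map s) (c • t) ^ n := by
  have hindep : iIndepFun (fun (i : Fin n) (x : Fin n → X) => s (x i)) (Measure.pi fun _ => P) :=
    iIndepFun_pi fun _ => hs.aemeasurable
  have hmeas (i : Fin n) : Measurable fun x : Fin n → X => s (x i) :=
    hs.comp (measurable_pi_apply i)
  have heval (i : Fin n) : (Measure.pi fun _ : Fin n => P).map (fun x => s (x i)) = P.map s :=
    (Measure.map_map hs (measurable_pi_apply i)).symm.trans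
      (by rw [(measurePreserving_eval (fun _ : Fin n => P) i).map_eq])
  rw [charFun_map_smul_comp (Finset.measurable_fun_sum _ fun i _ => hmeas i).aemeasurable,
    hindep.charFun_map_fun_sum_eq_prod fun i => (hmeas i).aemeasurable]
  simp [heval]

theorem norm_charFun_map_sub_le (P : Measure X) [IsProbabilityMeasure P] {s : X → E}
    (hs : Measurable s) (h3 : Integrable (fun x => ‖s x‖ ^ 3) P)
    (hmean : ∀ t, ∫ x, inner ℝ (s x) t ∂P = 0) (t : E) :
    ‖charFun (P.map s) t - 1 + ((∫ x, inner ℝ (s x) t ^ 2 ∂P : ℝ) : ℂ) / 2‖ ≤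
      ‖t‖ ^ 3 * ∫ x, ‖s x‖ ^ 3 ∂P := by
  have hL3 : MemLp s 3 P := (integrable_norm_rpow_iff hs.aestronglyMeasurable (p := 3)
    (by norm_num) (by norm_num)).1 (by simpa using h3)
  have hinner : MemLp (fun x => inner ℝ (s x) t) 3 P := hL3.inner_const t
  have hchar : charFun (P.map s) t = ∫ x, exp (I * (inner ℝ (s x) t : ℝ)) ∂P := by
    rw [charFun_apply, integral_map hs.aemeasurable (by fun_prop)]
    simp only [mul_comm I]
  rw [hchar, ← integral_const_mul]
  refine (norm_integral_exp_I_mul_sub_le P hinner (hmean t)).trans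
    (integral_mono (by simpa using hinner.integrable_norm_pow (by norm_num)) (h3.const_mul _)
      fun x => ?_)
  calc |inner ℝ (s x) t| ^ 3 ≤ (‖s x‖ * ‖t‖) ^ 3 := by gcongr; exact abs_real_inner_le_norm _ _
    _ = ‖t‖ ^ 3 * ‖s x‖ ^ 3 := by ring

theorem norm_natCast_mul_charFun_sub_one_add_le (P : Measure X) [IsProbabilityMeasure P]
    {s : X → E} (hs : Measurable s) (h3 : Integrable (fun x => ‖s x‖ ^ 3) P)
    (hmean : ∀ t, ∫ x, inner ℝ (s x) t ∂P = 0) (t : E) {n : ℕ} (hn : n ≠ 0) :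
    ‖(n : ℂ) * (charFun (P.map s) ((√(n : ℝ))⁻¹ • t) - 1) +
      ((∫ x, inner ℝ (s x) t ^ 2 ∂P : ℝ) : ℂ) / 2‖ ≤
        (√(n : ℝ))⁻¹ * (‖t‖ ^ 3 * ∫ x, ‖s x‖ ^ 3 ∂P) := by
  have hsqrt : 0 < √(n : ℝ) := Real.sqrt_pos.2 (Nat.cast_pos.2 hn.bot_lt)
  have hsq : √(n : ℝ) ^ 2 = n := Real.sq_sqrt n.cast_nonneg
  have hnC : (n : ℂ) ≠ 0 := Nat.cast_ne_zero.2 hn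
  have hscale : ∫ x, inner ℝ (s x) ((√(n : ℝ))⁻¹ • t) ^ 2 ∂P =
      (n : ℝ)⁻¹ * ∫ x, inner ℝ (s x) t ^ 2 ∂P := by
    simp_rw [real_inner_smul_right, mul_pow, inv_pow, hsq, integral_const_mul]
  have hle := norm_charFun_map_sub_le P hs h3 hmean ((√(n : ℝ))⁻¹ • t)
  rw [hscale] at hle
  calc _ = ‖(n : ℂ) * (charFun (P.map s) ((√(n : ℝ))⁻¹ • t) - 1 +
        (((n : ℝ)⁻¹ * ∫ x, inner ℝ (s x) t ^ 2 ∂P : ℝ) : ℂ) / 2)‖ := by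
        congr 1
        push_cast
        field_simp
    _ ≤ √(n : ℝ) ^ 2 * (‖(√(n : ℝ))⁻¹ • t‖ ^ 3 * ∫ x, ‖s x‖ ^ 3 ∂P) := by
        rw [norm_mul, Complex.norm_natCast, hsq]
        gcongr
    _ = (√(n : ℝ))⁻¹ * (‖t‖ ^ 3 * ∫ x, ‖s x‖ ^ 3 ∂P) := by
        rw [norm_smul, norm_inv, Real.norm_of_nonneg hsqrt.le]
        field_simp

variable (P : ℕ → Measure X) [∀ n, IsProbabilityMeasure (P n)]

theorem tendsto_charFun_inv_sqrt_smul_sum {s : ℕ → X → E} (hs : ∀ n, Measurable (s n)) {C : ℝ}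
    (h3 : ∀ᶠ n in atTop, Integrable (fun x => ‖s n x‖ ^ 3) (P n) ∧ ∫ x, ‖s n x‖ ^ 3 ∂P n ≤ C)
    (hmean : ∀ᶠ n in atTop, ∀ t, ∫ x, inner ℝ (s n x) t ∂P n = 0) {t : E} {q : ℝ}
    (hcov : Tendsto (fun n => ∫ x, inner ℝ (s n x) t ^ 2 ∂P n) atTop (𝓝 q)) :
    Tendsto (fun n => charFun ((Measure.pi fun _ : Fin n => P n).map
      fun x => (√(n : ℝ))⁻¹ • ∑ i, s n (x i)) t) atTop (𝓝 (exp (-((q : ℂ) / 2)))) := by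
  simp only [charFun_map_smul_sum_pi _ (hs _)]
  have hquad : Tendsto (fun n => -(((∫ x, inner ℝ (s n x) t ^ 2 ∂P n : ℝ) : ℂ) / 2)) atTop
      (𝓝 (-((q : ℂ) / 2))) :=
    (((Complex.continuous_ofReal.tendsto _).comp hcov).div_const 2).neg
  have herror : Tendsto (fun n : ℕ => (√(n : ℝ))⁻¹ * (‖t‖ ^ 3 * C)) atTop (𝓝 0) := by
    simpa using tendsto_inv_sqrt_natCast.mul_const (‖t‖ ^ 3 * C)
  have hlog : Tendsto (fun n : ℕ => (n : ℂ) *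
      (charFun ((P n).map (s n)) ((√(n : ℝ))⁻¹ • t) - 1)) atTop (𝓝 (-((q : ℂ) / 2))) := by
    refine tendsto_of_tendsto_of_dist hquad
      (squeeze_zero' (Eventually.of_forall fun _ => dist_nonneg) ?_ herror)
    filter_upwards [h3, hmean, eventually_gt_atTop 0] with n ⟨hint, hC⟩ hmean hn
    rw [dist_comm, dist_eq_norm, sub_neg_eq_add]
    refine (norm_natCast_mul_charFun_sub_one_add_le (P n) (hs n) hint hmean t hn.ne').trans ?_
    gcongr
  simpa using Complex.tendsto_one_add_pow_exp_of_tendsto hlog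

theorem tendstoInDistribution_inv_sqrt_smul_sum {ι : Type*} [Fintype ι] [DecidableEq ι]
    {s : ℕ → X → EuclideanSpace ℝ ι} (hs : ∀ n, Measurable (s n)) {Γ : Matrix ι ι ℝ}
    (hΓ : Γ.PosSemidef) {C : ℝ}
    (h3 : ∀ᶠ n in atTop, Integrable (fun x => ‖s n x‖ ^ 3) (P n) ∧ ∫ x, ‖s n x‖ ^ 3 ∂P n ≤ C)
    (hmean : ∀ᶠ n in atTop, ∀ t, ∫ x, inner ℝ (s n x) t ∂P n = 0)
    (hcov : ∀ t : EuclideanSpace ℝ ι, Tendsto (fun n => ∫ x, inner ℝ (s n x) t ^ 2 ∂P n) atTop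
      (𝓝 (t.ofLp ⬝ᵥ (Γ *ᵥ t.ofLp)))) :
    TendstoInDistribution
      (fun n (x : Fin n → X) => (√(n : ℝ))⁻¹ • ∑ i, s n (x i)) atTop id
      (fun n => Measure.pi fun _ : Fin n => P n) (multivariateGaussian 0 Γ) where
  forall_aemeasurable n := (measurable_smul_sum (hs n) _).aemeasurable
  aemeasurable_limit := by fun_prop
  tendsto := by
    refine ProbabilityMeasure.tendsto_iff_tendsto_charFun.2 fun t => ?_
    have hlimit := tendsto_charFun_inv_sqrt_smul_sum P hs h3 hmean (hcov t)
    simpa [Measure.map_id, charFun_multivariateGaussian hΓ] using hlimit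

end CentralLimit

section Taylor

theorem abs_sub_taylor_two_le {φ φ' φ'' : ℝ → ℝ}
    (h₁ : ∀ t ∈ Set.Icc (0 : ℝ) 1, HasDerivAt φ (φ' t) t)
    (h₂ : ∀ t ∈ Set.Icc (0 : ℝ) 1, HasDerivAt φ' (φ'' t) t) {a c : ℝ}
    (hc : ∀ t ∈ Set.Icc (0 : ℝ) 1, |φ'' t - a| ≤ c) :
    |φ 1 - φ 0 - φ' 0 - 1 / 2 * a| ≤ c := by
  have mem₀ : (0 : ℝ) ∈ Set.Icc (0 : ℝ) 1 := Set.left_mem_Icc.2 zero_le_one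
  have first_order : ∀ t ∈ Set.Icc (0 : ℝ) 1, |φ' t - φ' 0 - t * a| ≤ c := fun t ht => by
    have h := (convex_Icc (0 : ℝ) 1).norm_image_sub_le_of_norm_hasDerivWithin_le
      (f := fun t => φ' t - t * a)
      (fun s hs => ((h₂ s hs).sub (hasDerivAt_mul_const a)).hasDerivWithinAt) hc mem₀ ht
    have ht' : |t - 0| ≤ 1 := abs_le.2 ⟨by linarith [ht.1], by linarith [ht.2]⟩
    calc |φ' t - φ' 0 - t * a| = |φ' t - t * a - (φ' 0 - 0 * a)| := by ring_nf
      _ ≤ c * |t - 0| := h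
      _ ≤ c := mul_le_of_le_one_right ((abs_nonneg _).trans (hc 0 mem₀)) ht'
  have hquad (t : ℝ) : HasDerivAt (fun t : ℝ => t ^ 2 * (1 / 2 * a)) (t * a) t := by
    convert! (hasDerivAt_pow 2 t).mul_const (1 / 2 * a) using 1
    ring
  have h := (convex_Icc (0 : ℝ) 1).norm_image_sub_le_of_norm_hasDerivWithin_le
    (f := fun t => φ t - t * φ' 0 - t ^ 2 * (1 / 2 * a))
    (fun s hs => (((h₁ s hs).sub (hasDerivAt_mul_const (φ' 0))).sub (hquad s)).hasDerivWithinAt)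
    first_order mem₀ (Set.right_mem_Icc.2 zero_le_one)
  calc |φ 1 - φ 0 - φ' 0 - 1 / 2 * a|
      = |φ 1 - 1 * φ' 0 - 1 ^ 2 * (1 / 2 * a) - (φ 0 - 0 * φ' 0 - 0 ^ 2 * (1 / 2 * a))| := by
        ring_nf
    _ ≤ c * |(1 : ℝ) - 0| := h
    _ = c := by simp

theorem abs_sub_taylor_two_le_of_hasFDerivAt {E : Type*} [NormedAddCommGroup E] [NormedSpace ℝ E]
    {s : Set E} (hs : Convex ℝ s) {f : E → ℝ} {D₁ : E → E →L[ℝ] ℝ} {D₂ : E → E →L[ℝ] E →L[ℝ] ℝ}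
    (h₁ : ∀ θ ∈ s, HasFDerivAt f (D₁ θ) θ) (h₂ : ∀ θ ∈ s, HasFDerivAt D₁ (D₂ θ) θ)
    (A : E →L[ℝ] E →L[ℝ] ℝ) {c : ℝ} (hc : ∀ θ ∈ s, ‖D₂ θ - A‖ ≤ c) {θ η : E} (hθ : θ ∈ s)
    (hη : θ + η ∈ s) : |f (θ + η) - f θ - D₁ θ η - 1 / 2 * A η η| ≤ c * ‖η‖ ^ 2 := by
  have hmem : ∀ t ∈ Set.Icc (0 : ℝ) 1, θ + t • η ∈ s := fun t ht => by
    simpa using hs.add_smul_sub_mem hθ hη ht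
  have hline (t : ℝ) : HasDerivAt (fun t : ℝ => θ + t • η) η t := by
    simpa using ((hasDerivAt_id t).smul_const η).const_add θ
  have h := abs_sub_taylor_two_le (φ := fun t => f (θ + t • η)) (φ' := fun t => D₁ (θ + t • η) η)
    (φ'' := fun t => D₂ (θ + t • η) η η) (a := A η η) (c := c * ‖η‖ ^ 2)
    (fun t ht => (h₁ _ (hmem t ht)).comp_hasDerivAt t (hline t))
    (fun t ht => (ContinuousLinearMap.apply ℝ ℝ η).hasFDerivAt.comp_hasDerivAt t
      ((h₂ _ (hmem t ht)).comp_hasDerivAt t (hline t)))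
    (fun t ht => calc
      ‖(D₂ (θ + t • η) - A) η η‖ ≤ ‖D₂ (θ + t • η) - A‖ * ‖η‖ * ‖η‖ :=
        ContinuousLinearMap.le_opNorm₂ _ _ _
      _ ≤ c * ‖η‖ * ‖η‖ := by gcongr; exact hc _ (hmem t ht)
      _ = c * ‖η‖ ^ 2 := by ring)
  simpa using h

end Taylor

section RegularFamily

set_option maxSynthPendingDepth 3

variable {E X : Type*} [NormedAddCommGroup E] [NormedSpace ℝ E] [MeasurableSpace X]

/-- A family of log-densities `ℓ θ`, for `θ` in a ball around `θ₀`, with first derivative `S₁` and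
second derivative `S₂`: the densities are dominated by `w` and the first derivatives by `b ≥ 1`,
where `b ^ 3 * w` is integrable, and the second derivatives are bounded and equicontinuous at `θ₀`.
These conditions imply local asymptotic normality at `θ₀`. -/
structure RegularFamily (vol : Measure X) (ℓ : E → X → ℝ) (S₁ : E → X → E →L[ℝ] ℝ)
    (S₂ : E → X → E →L[ℝ] E →L[ℝ] ℝ) (b w : X → ℝ) (θ₀ : E) (r C : ℝ) : Prop where
  pos : 0 < r
  hasFDerivAt : ∀ θ ∈ Metric.ball θ₀ r, ∀ x, HasFDerivAt (fun θ => ℓ θ x) (S₁ θ x) θ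
  hasFDerivAt' : ∀ θ ∈ Metric.ball θ₀ r, ∀ x, HasFDerivAt (fun θ => S₁ θ x) (S₂ θ x) θ
  measurable : ∀ θ ∈ Metric.ball θ₀ r, Measurable (ℓ θ)
  stronglyMeasurable₁ : ∀ θ ∈ Metric.ball θ₀ r, StronglyMeasurable (S₁ θ)
  stronglyMeasurable₂ : ∀ θ ∈ Metric.ball θ₀ r, StronglyMeasurable (S₂ θ)
  measurable_b : Measurable b
  measurable_w : Measurable w
  exp_le : ∀ θ ∈ Metric.ball θ₀ r, ∀ x, Real.exp (ℓ θ x) ≤ w x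
  norm_le₁ : ∀ θ ∈ Metric.ball θ₀ r, ∀ x, ‖S₁ θ x‖ ≤ b x
  norm_le₂ : ∀ θ ∈ Metric.ball θ₀ r, ∀ x, ‖S₂ θ x‖ ≤ C
  one_le : ∀ x, 1 ≤ b x
  integrable : Integrable (fun x => b x ^ 3 * w x) vol
  equicontinuous : ∀ ε > 0, ∀ᶠ θ in 𝓝 θ₀, ∀ x, ‖S₂ θ x - S₂ θ₀ x‖ ≤ ε
  isProbabilityMeasure : ∀ θ ∈ Metric.ball θ₀ r, IsProbabilityMeasure (withLogDensity vol (ℓ θ))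

namespace RegularFamily

variable {vol : Measure X} {ℓ : E → X → ℝ} {S₁ : E → X → E →L[ℝ] ℝ}
  {S₂ : E → X → E →L[ℝ] E →L[ℝ] ℝ} {b w : X → ℝ} {θ₀ : E} {r C : ℝ}
  {F : Type*} [NormedAddCommGroup F] [NormedSpace ℝ F]

theorem mem_ball (h : RegularFamily vol ℓ S₁ S₂ b w θ₀ r C) : θ₀ ∈ Metric.ball θ₀ r :=
  Metric.mem_ball_self h.pos

theorem b_nonneg (h : RegularFamily vol ℓ S₁ S₂ b w θ₀ r C) (x : X) : 0 ≤ b x :=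
  zero_le_one.trans (h.one_le x)

theorem w_nonneg (h : RegularFamily vol ℓ S₁ S₂ b w θ₀ r C) (x : X) : 0 ≤ w x :=
  (Real.exp_pos _).le.trans (h.exp_le θ₀ h.mem_ball x)

theorem integrable_pow_mul (h : RegularFamily vol ℓ S₁ S₂ b w θ₀ r C) {j : ℕ} (hj : j ≤ 3) :
    Integrable (fun x => b x ^ j * w x) vol := by
  refine h.integrable.mono' ((h.measurable_b.pow_const j).mul h.measurable_w).aestronglyMeasurable
    (Eventually.of_forall fun x => ?_)
  have := h.b_nonneg x
  have := h.w_nonneg x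
  rw [Real.norm_of_nonneg (by positivity)]
  gcongr
  exact h.one_le x

theorem norm_exp_smul_le (h : RegularFamily vol ℓ S₁ S₂ b w θ₀ r C) {θ : E}
    (hθ : θ ∈ Metric.ball θ₀ r) {y : F} {x : X} {a : ℝ} (hy : ‖y‖ ≤ a) :
    ‖Real.exp (ℓ θ x) • y‖ ≤ a * w x := by
  rw [norm_smul, Real.norm_of_nonneg (Real.exp_pos _).le, mul_comm]
  exact mul_le_mul hy (h.exp_le θ hθ x) (Real.exp_pos _).le ((norm_nonneg _).trans hy)

theorem integrable_of_norm_le (h : RegularFamily vol ℓ S₁ S₂ b w θ₀ r C) {θ : E}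
    (hθ : θ ∈ Metric.ball θ₀ r) {g : X → F} (hg : AEStronglyMeasurable g vol) {K : ℝ} {j : ℕ}
    (hj : j ≤ 3) (hb : ∀ x, ‖g x‖ ≤ K * b x ^ j) :
    Integrable g (withLogDensity vol (ℓ θ)) := by
  rw [integrable_withLogDensity_iff (h.measurable θ hθ)]
  refine ((h.integrable_pow_mul hj).const_mul K).mono'
    ((h.measurable θ hθ).exp.aestronglyMeasurable.smul hg) (Eventually.of_forall fun x => ?_)
  rw [← mul_assoc]
  exact h.norm_exp_smul_le hθ (hb x)

theorem integrable_score (h : RegularFamily vol ℓ S₁ S₂ b w θ₀ r C) {θ : E}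
    (hθ : θ ∈ Metric.ball θ₀ r) : Integrable (S₁ θ) (withLogDensity vol (ℓ θ)) :=
  h.integrable_of_norm_le hθ (h.stronglyMeasurable₁ θ hθ).aestronglyMeasurable (K := 1) (j := 1)
    (by norm_num) (by simpa using h.norm_le₁ θ hθ)

theorem integrable_hess (h : RegularFamily vol ℓ S₁ S₂ b w θ₀ r C) {θ : E}
    (hθ : θ ∈ Metric.ball θ₀ r) : Integrable (S₂ θ) (withLogDensity vol (ℓ θ)) :=
  h.integrable_of_norm_le hθ (h.stronglyMeasurable₂ θ hθ).aestronglyMeasurable (K := C) (j := 0)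
    (by norm_num) (by simpa using h.norm_le₂ θ hθ)

theorem integrable_score_smulRight_score (h : RegularFamily vol ℓ S₁ S₂ b w θ₀ r C) {θ : E}
    (hθ : θ ∈ Metric.ball θ₀ r) :
    Integrable (fun x => (S₁ θ x).smulRight (S₁ θ x)) (withLogDensity vol (ℓ θ)) := by
  have hm := (h.stronglyMeasurable₁ θ hθ).aestronglyMeasurable (μ := vol)
  refine h.integrable_of_norm_le hθ ((ContinuousLinearMap.smulRightL ℝ E (E →L[ℝ] ℝ)).continuous₂
    |>.comp_aestronglyMeasurable (hm.prodMk hm)) (K := 1) (j := 2) (by norm_num) fun x => ?_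
  rw [ContinuousLinearMap.norm_smulRight_apply, one_mul, ← sq]
  gcongr
  exact h.norm_le₁ θ hθ x

theorem integral_exp_eq_one (h : RegularFamily vol ℓ S₁ S₂ b w θ₀ r C) {θ : E}
    (hθ : θ ∈ Metric.ball θ₀ r) : ∫ x, Real.exp (ℓ θ x) ∂vol = 1 := by
  have := h.isProbabilityMeasure θ hθ
  simpa using (integral_withLogDensity (μ := vol) (h.measurable θ hθ) fun _ => (1 : ℝ)).symm

theorem integral_score (h : RegularFamily vol ℓ S₁ S₂ b w θ₀ r C) {θ : E}
    (hθ : θ ∈ Metric.ball θ₀ r) : ∫ x, S₁ θ x ∂withLogDensity vol (ℓ θ) = 0 := by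
  have hball := Metric.isOpen_ball.mem_nhds hθ
  have hderiv := hasFDerivAt_integral_of_dominated_of_fderiv_le (μ := vol)
    (F := fun θ x => Real.exp (ℓ θ x)) (F' := fun θ x => Real.exp (ℓ θ x) • S₁ θ x)
    (bound := fun x => b x ^ 1 * w x) hball
    (by filter_upwards [hball] with θ' hθ'
        exact (h.measurable θ' hθ').exp.aestronglyMeasurable)
    (integrable_of_integral_eq_one (h.integral_exp_eq_one hθ))
    ((integrable_withLogDensity_iff (h.measurable θ hθ)).1 (h.integrable_score hθ)).1
    (Eventually.of_forall fun x θ' hθ' =>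
      h.norm_exp_smul_le hθ' ((h.norm_le₁ θ' hθ' x).trans_eq (pow_one _).symm))
    (h.integrable_pow_mul (by norm_num))
    (Eventually.of_forall fun x θ' hθ' => (h.hasFDerivAt θ' hθ' x).exp)
  have hconst : HasFDerivAt (fun θ => ∫ x, Real.exp (ℓ θ x) ∂vol) (0 : E →L[ℝ] ℝ) θ := by
    refine (hasFDerivAt_const (1 : ℝ) θ).congr_of_eventuallyEq ?_
    filter_upwards [hball] with θ' hθ' using h.integral_exp_eq_one hθ'
  rw [integral_withLogDensity (h.measurable θ hθ)]
  exact hderiv.unique hconst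

theorem hasFDerivAt_integral_exp_smul_score (h : RegularFamily vol ℓ S₁ S₂ b w θ₀ r C) {θ : E}
    (hθ : θ ∈ Metric.ball θ₀ r) :
    HasFDerivAt (fun θ => ∫ x, Real.exp (ℓ θ x) • S₁ θ x ∂vol)
      (∫ x, (Real.exp (ℓ θ x) • S₂ θ x + (Real.exp (ℓ θ x) • S₁ θ x).smulRight (S₁ θ x)) ∂vol)
      θ := by
  have hball := Metric.isOpen_ball.mem_nhds hθ
  have hexp {θ : E} (hθ : θ ∈ Metric.ball θ₀ r) :
      AEStronglyMeasurable (fun x => Real.exp (ℓ θ x)) vol :=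
    (h.measurable θ hθ).exp.aestronglyMeasurable
  have hm₁ {θ : E} (hθ : θ ∈ Metric.ball θ₀ r) : AEStronglyMeasurable (S₁ θ) vol :=
    (h.stronglyMeasurable₁ θ hθ).aestronglyMeasurable
  refine hasFDerivAt_integral_of_dominated_of_fderiv_le
    (F' := fun θ x => Real.exp (ℓ θ x) • S₂ θ x +
      (Real.exp (ℓ θ x) • S₁ θ x).smulRight (S₁ θ x))
    (bound := fun x => C * (b x ^ 0 * w x) + b x ^ 2 * w x) hball
    (by filter_upwards [hball] with θ' hθ' using (hexp hθ').smul (hm₁ hθ'))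
    ((integrable_withLogDensity_iff (h.measurable θ hθ)).1 (h.integrable_score hθ))
    (((hexp hθ).smul (h.stronglyMeasurable₂ θ hθ).aestronglyMeasurable).add
      ((ContinuousLinearMap.smulRightL ℝ E (E →L[ℝ] ℝ)).continuous₂.comp_aestronglyMeasurable
        (((hexp hθ).smul (hm₁ hθ)).prodMk (hm₁ hθ))))
    (Eventually.of_forall fun x θ' hθ' => (norm_add_le _ _).trans (add_le_add ?_ ?_))
    (((h.integrable_pow_mul (by norm_num)).const_mul C).add (h.integrable_pow_mul (by norm_num)))
    (Eventually.of_forall fun x θ' hθ' => (h.hasFDerivAt θ' hθ' x).exp.smul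
      (h.hasFDerivAt' θ' hθ' x))
  · rw [pow_zero, one_mul]
    exact h.norm_exp_smul_le hθ' (h.norm_le₂ θ' hθ' x)
  · rw [ContinuousLinearMap.norm_smulRight_apply]
    calc ‖Real.exp (ℓ θ' x) • S₁ θ' x‖ * ‖S₁ θ' x‖ ≤ (b x * w x) * b x :=
          mul_le_mul (h.norm_exp_smul_le hθ' (h.norm_le₁ θ' hθ' x)) (h.norm_le₁ θ' hθ' x)
            (norm_nonneg _) (mul_nonneg (h.b_nonneg x) (h.w_nonneg x))
      _ = b x ^ 2 * w x := by ring

theorem integral_hess (h : RegularFamily vol ℓ S₁ S₂ b w θ₀ r C) {θ : E}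
    (hθ : θ ∈ Metric.ball θ₀ r) :
    ∫ x, S₂ θ x ∂withLogDensity vol (ℓ θ) =
      -∫ x, (S₁ θ x).smulRight (S₁ θ x) ∂withLogDensity vol (ℓ θ) := by
  have hm := h.measurable θ hθ
  have hconst : HasFDerivAt (fun θ => ∫ x, Real.exp (ℓ θ x) • S₁ θ x ∂vol)
      (0 : E →L[ℝ] E →L[ℝ] ℝ) θ := by
    refine (hasFDerivAt_const (0 : E →L[ℝ] ℝ) θ).congr_of_eventuallyEq ?_
    filter_upwards [Metric.isOpen_ball.mem_nhds hθ] with θ' hθ'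
    rw [← integral_withLogDensity (h.measurable θ' hθ'), h.integral_score hθ']
  have hsmul (x : X) : (Real.exp (ℓ θ x) • S₁ θ x).smulRight (S₁ θ x) =
      Real.exp (ℓ θ x) • (S₁ θ x).smulRight (S₁ θ x) := by
    ext
    simp [mul_assoc]
  have hsum := (h.hasFDerivAt_integral_exp_smul_score hθ).unique hconst
  simp only [hsmul] at hsum
  rw [integral_add ((integrable_withLogDensity_iff hm).1 (h.integrable_hess hθ))
    ((integrable_withLogDensity_iff hm).1 (h.integrable_score_smulRight_score hθ)),
    ← integral_withLogDensity hm, ← integral_withLogDensity hm] at hsum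
  exact eq_neg_of_add_eq_zero_left hsum

theorem integral_hess_apply_apply (h : RegularFamily vol ℓ S₁ S₂ b w θ₀ r C) {θ : E}
    (hθ : θ ∈ Metric.ball θ₀ r) (u v : E) :
    ∫ x, S₂ θ x u v ∂withLogDensity vol (ℓ θ) =
      -∫ x, S₁ θ x u * S₁ θ x v ∂withLogDensity vol (ℓ θ) := by
  have happly {B : X → E →L[ℝ] E →L[ℝ] ℝ} (hB : Integrable B (withLogDensity vol (ℓ θ))) :
      (∫ x, B x ∂withLogDensity vol (ℓ θ)) u v = ∫ x, B x u v ∂withLogDensity vol (ℓ θ) := by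
    rw [ContinuousLinearMap.integral_apply hB,
      ContinuousLinearMap.integral_apply (hB.apply_continuousLinearMap u)]
  have hneg := congrArg (fun L : E →L[ℝ] E →L[ℝ] ℝ => L u v) (h.integral_hess hθ)
  simpa only [neg_apply, happly (h.integrable_hess hθ),
    happly (h.integrable_score_smulRight_score hθ), ContinuousLinearMap.smulRight_apply,
    smul_apply, smul_eq_mul] using hneg

theorem tendsto_integral (h : RegularFamily vol ℓ S₁ S₂ b w θ₀ r C) {g : E → X → F}
    (hg : ∀ θ ∈ Metric.ball θ₀ r, AEStronglyMeasurable (g θ) vol)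
    (hc : ∀ x, ContinuousAt (fun θ => g θ x) θ₀) {K : ℝ} {j : ℕ} (hj : j ≤ 3)
    (hb : ∀ θ ∈ Metric.ball θ₀ r, ∀ x, ‖g θ x‖ ≤ K * b x ^ j) :
    Tendsto (fun θ => ∫ x, g θ x ∂withLogDensity vol (ℓ θ)) (𝓝 θ₀)
      (𝓝 (∫ x, g θ₀ x ∂withLogDensity vol (ℓ θ₀))) := by
  have hball := Metric.ball_mem_nhds θ₀ h.pos
  rw [integral_withLogDensity (h.measurable θ₀ h.mem_ball)]
  have hcongr : (fun θ => ∫ x, Real.exp (ℓ θ x) • g θ x ∂vol) =ᶠ[𝓝 θ₀]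
      fun θ => ∫ x, g θ x ∂withLogDensity vol (ℓ θ) := by
    filter_upwards [hball] with θ hθ using (integral_withLogDensity (h.measurable θ hθ) _).symm
  refine (tendsto_integral_filter_of_dominated_convergence (fun x => K * b x ^ j * w x)
    ?_ ?_ ?_ (Eventually.of_forall fun x => ?_)).congr' hcongr
  · filter_upwards [hball] with θ hθ
    exact (h.measurable θ hθ).exp.aestronglyMeasurable.smul (hg θ hθ)
  · filter_upwards [hball] with θ hθ using
      Eventually.of_forall fun x => h.norm_exp_smul_le hθ (hb θ hθ x)
  · simpa only [mul_assoc] using (h.integrable_pow_mul hj).const_mul K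
  · exact (h.hasFDerivAt θ₀ h.mem_ball x).continuousAt.rexp.smul (hc x)

end RegularFamily

end RegularFamily

section Expansion

theorem apply_apply_eq_sum_inner {ι E : Type*} [Fintype ι] [NormedAddCommGroup E]
    [InnerProductSpace ℝ E] (e : OrthonormalBasis ι ℝ E) (B : E →L[ℝ] E →L[ℝ] ℝ) (u v : E) :
    B u v = ∑ i, ∑ j, inner ℝ (e i) u * inner ℝ (e j) v * B (e i) (e j) := by
  conv_lhs => rw [← e.sum_repr' u, ← e.sum_repr' v]
  simp only [map_sum, map_smul, sum_apply, smul_apply, smul_eq_mul, Finset.mul_sum]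
  rw [Finset.sum_comm]
  exact Finset.sum_congr rfl fun i _ => Finset.sum_congr rfl fun j _ => by ring

theorem IsLittleOP.apply_apply {E : Type*} [NormedAddCommGroup E] [InnerProductSpace ℝ E]
    [FiniteDimensional ℝ E] {Ω : ℕ → Type*} [∀ n, MeasurableSpace (Ω n)] {P : ∀ n, Measure (Ω n)}
    {B : ∀ n, Ω n → E →L[ℝ] E →L[ℝ] ℝ} (hB : ∀ u v, IsLittleOP P fun n ω => B n ω u v)
    {η : ℕ → E} {K : ℝ} (hη : ∀ n, ‖η n‖ ≤ K) :
    IsLittleOP P fun n ω => B n ω (η n) (η n) := by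
  let e := stdOrthonormalBasis ℝ E
  have hcoord (i) (n : ℕ) : |inner ℝ (e i) (η n)| ≤ K := by
    refine (abs_real_inner_le_norm _ _).trans ?_
    rw [e.norm_eq_one, one_mul]
    exact hη n
  simp only [fun n ω => apply_apply_eq_sum_inner e (B n ω) (η n) (η n)]
  refine IsLittleOP.sum _ fun i _ => IsLittleOP.sum _ fun j _ =>
    (hB (e i) (e j)).mul_of_abs_le (C := K * K) fun n => ?_
  rw [abs_mul]
  exact mul_le_mul (hcoord i n) (hcoord j n) (abs_nonneg _) ((abs_nonneg _).trans (hcoord i n))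

namespace RegularFamily

section NormedSpace

variable {E X : Type*} [NormedAddCommGroup E] [NormedSpace ℝ E] [MeasurableSpace X]
  {vol : Measure X} {ℓ : E → X → ℝ} {S₁ : E → X → E →L[ℝ] ℝ} {S₂ : E → X → E →L[ℝ] E →L[ℝ] ℝ}
  {b w : X → ℝ} {θ₀ : E} {r C K : ℝ} {P : ℕ → Measure X} {θ η : ℕ → E}

theorem isLittleOP_average_hess_sub [∀ n, IsProbabilityMeasure (P n)]
    (h : RegularFamily vol ℓ S₁ S₂ b w θ₀ r C) (hθ : Tendsto θ atTop (𝓝 θ₀))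
    (hP : ∀ n, P n = withLogDensity vol (ℓ (θ n))) (u v : E) :
    IsLittleOP (fun n => Measure.pi fun _ : Fin n => P n) fun n x =>
      (n : ℝ)⁻¹ * ∑ i, S₂ θ₀ (x i) u v - ∫ x, S₂ θ₀ x u v ∂withLogDensity vol (ℓ θ₀) := by
  have hmeas (μ : Measure X) : AEStronglyMeasurable (fun x => S₂ θ₀ x u v) μ :=
    ((h.stronglyMeasurable₂ θ₀ h.mem_ball).aestronglyMeasurable.apply_continuousLinearMap
      u).apply_continuousLinearMap v
  have hbound (x : X) : ‖S₂ θ₀ x u v‖ ≤ C * ‖u‖ * ‖v‖ := by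
    refine (ContinuousLinearMap.le_opNorm₂ _ _ _).trans ?_
    gcongr
    exact h.norm_le₂ θ₀ h.mem_ball x
  have hlim : Tendsto (fun n => ∫ x, S₂ θ₀ x u v ∂P n) atTop
      (𝓝 (∫ x, S₂ θ₀ x u v ∂withLogDensity vol (ℓ θ₀))) := by
    simp only [hP]
    refine (h.tendsto_integral (g := fun _ x => S₂ θ₀ x u v) (fun _ _ => hmeas vol)
      (fun _ => continuousAt_const) (K := C * ‖u‖ * ‖v‖) (j := 0) (by norm_num) ?_).comp hθ
    simpa using fun _ _ => hbound
  exact isLittleOP_average_sub P (g := fun x => S₂ θ₀ x u v)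
    (fun n => MemLp.of_bound (hmeas _) _ (Eventually.of_forall hbound))
    (fun n => variance_le_sq_of_bounded
      (Eventually.of_forall fun x => abs_le.1 (hbound x)) (hmeas _).aemeasurable) hlim

theorem eventually_abs_sub_taylor_two_le (h : RegularFamily vol ℓ S₁ S₂ b w θ₀ r C) {ε : ℝ}
    (hε : 0 < ε) :
    ∀ᶠ p : E × E in 𝓝 (θ₀, 0), ∀ x, |ℓ (p.1 + p.2) x - ℓ p.1 x - S₁ p.1 x p.2 -
      1 / 2 * S₂ θ₀ x p.2 p.2| ≤ ε * ‖p.2‖ ^ 2 := by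
  obtain ⟨ρ, hρ, hball⟩ := Metric.eventually_nhds_iff_ball.1
    ((h.equicontinuous ε hε).and (Metric.ball_mem_nhds θ₀ h.pos))
  have hfst : Tendsto Prod.fst (𝓝 (θ₀, (0 : E))) (𝓝 θ₀) := continuous_fst.tendsto _
  have hadd : Tendsto (fun p : E × E => p.1 + p.2) (𝓝 (θ₀, 0)) (𝓝 θ₀) := by
    simpa using (continuous_add (M := E)).tendsto (θ₀, 0)
  filter_upwards [hfst (Metric.ball_mem_nhds θ₀ hρ), hadd (Metric.ball_mem_nhds θ₀ hρ)]
    with p hp₁ hp₂ x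
  exact abs_sub_taylor_two_le_of_hasFDerivAt (convex_ball θ₀ ρ)
    (fun θ hθ => h.hasFDerivAt θ (hball θ hθ).2 x) (fun θ hθ => h.hasFDerivAt' θ (hball θ hθ).2 x)
    (S₂ θ₀ x) (fun θ hθ => (hball θ hθ).1 x) hp₁ hp₂

theorem eventually_abs_sum_sub_taylor_two_le (h : RegularFamily vol ℓ S₁ S₂ b w θ₀ r C)
    (hθ : Tendsto θ atTop (𝓝 θ₀)) (hη : ∀ n, ‖η n‖ ≤ K) {ε : ℝ} (hε : 0 < ε) :
    ∀ᶠ n : ℕ in atTop, ∀ x : Fin n → X,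
      |∑ i, (ℓ (θ n + (√(n : ℝ))⁻¹ • η n) (x i) - ℓ (θ n) (x i) -
        S₁ (θ n) (x i) ((√(n : ℝ))⁻¹ • η n) -
        1 / 2 * S₂ θ₀ (x i) ((√(n : ℝ))⁻¹ • η n) ((√(n : ℝ))⁻¹ • η n))| ≤ ε := by
  have : 0 ≤ K := (norm_nonneg _).trans (hη 0)
  have hstep : Tendsto (fun n : ℕ => (√(n : ℝ))⁻¹ • η n) atTop (𝓝 0) :=
    tendsto_inv_sqrt_natCast.zero_smul_isBoundedUnder_le (isBoundedUnder_of ⟨K, hη⟩)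
  filter_upwards [(hθ.prodMk_nhds hstep).eventually (h.eventually_abs_sub_taylor_two_le
    (show 0 < ε / (K ^ 2 + 1) by positivity)), eventually_gt_atTop 0] with n hn hpos x
  have hn₀ : (0 : ℝ) < n := by exact_mod_cast hpos
  have hsq : ‖(√(n : ℝ))⁻¹ • η n‖ ^ 2 ≤ (n : ℝ)⁻¹ * K ^ 2 := by
    rw [norm_smul, mul_pow, Real.norm_eq_abs, sq_abs, inv_pow, Real.sq_sqrt hn₀.le]
    gcongr
    exact hη n
  calc _ ≤ ∑ _i : Fin n, ε / (K ^ 2 + 1) * ((n : ℝ)⁻¹ * K ^ 2) :=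
        (Finset.abs_sum_le_sum_abs _ _).trans
          (Finset.sum_le_sum fun i _ => (hn (x i)).trans (by gcongr))
    _ = ε * (K ^ 2 / (K ^ 2 + 1)) := by
        rw [Finset.sum_const, Finset.card_univ, Fintype.card_fin, nsmul_eq_mul]
        field_simp
    _ ≤ ε := mul_le_of_le_one_right hε.le ((div_le_one (by positivity)).2 (by linarith))

end NormedSpace

section InnerProductSpace

variable {E X : Type*} [NormedAddCommGroup E] [InnerProductSpace ℝ E] [MeasurableSpace X]
  {vol : Measure X} {ℓ : E → X → ℝ} {S₁ : E → X → E →L[ℝ] ℝ} {S₂ : E → X → E →L[ℝ] E →L[ℝ] ℝ}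
  {b w : X → ℝ} {θ₀ : E} {r C K : ℝ} {P : ℕ → Measure X} {θ η : ℕ → E}

theorem isLittleOP_logLikelihood_sub [FiniteDimensional ℝ E] [∀ n, IsProbabilityMeasure (P n)]
    (h : RegularFamily vol ℓ S₁ S₂ b w θ₀ r C) (hθ : Tendsto θ atTop (𝓝 θ₀))
    (hP : ∀ n, P n = withLogDensity vol (ℓ (θ n))) (hη : ∀ n, ‖η n‖ ≤ K) :
    IsLittleOP (fun n => Measure.pi fun _ : Fin n => P n) fun n x =>
      ∑ i, (ℓ (θ n + (√(n : ℝ))⁻¹ • η n) (x i) - ℓ (θ n) (x i)) -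
        ((√(n : ℝ))⁻¹ * ∑ i, S₁ (θ n) (x i) (η n) -
          1 / 2 * ∫ x, S₁ θ₀ x (η n) ^ 2 ∂withLogDensity vol (ℓ θ₀)) := by
  set A := ∫ x, S₂ θ₀ x ∂withLogDensity vol (ℓ θ₀)
  have hA (u v : E) : A u v = ∫ x, S₂ θ₀ x u v ∂withLogDensity vol (ℓ θ₀) := by
    have hi := h.integrable_hess h.mem_ball
    rw [ContinuousLinearMap.integral_apply hi,
      ContinuousLinearMap.integral_apply (hi.apply_continuousLinearMap u)]
  have hinfo (n : ℕ) : ∫ x, S₁ θ₀ x (η n) ^ 2 ∂withLogDensity vol (ℓ θ₀) = -A (η n) (η n) := by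
    simp only [sq, hA, h.integral_hess_apply_apply h.mem_ball, neg_neg]
  have hhess : IsLittleOP (fun n => Measure.pi fun _ : Fin n => P n) fun n x =>
      1 / 2 * ((n : ℝ)⁻¹ • ∑ i, S₂ θ₀ (x i) - A) (η n) (η n) := by
    refine (IsLittleOP.apply_apply (fun u v => ?_) hη).mul_of_abs_le fun _ => le_rfl
    simpa [hA] using h.isLittleOP_average_hess_sub hθ hP u v
  refine ((IsLittleOP.of_forall_eventually_abs_le fun ε hε =>
    h.eventually_abs_sum_sub_taylor_two_le hθ hη hε).add hhess).of_abs_le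
      (Eventually.of_forall fun n => Eventually.of_forall fun x => le_of_eq (congrArg _ ?_))
  have hsq : (√(n : ℝ))⁻¹ ^ 2 = (n : ℝ)⁻¹ := by rw [inv_pow, Real.sq_sqrt n.cast_nonneg]
  rw [hinfo, ← hsq]
  simp only [map_smul, smul_apply, sub_apply, sum_apply, smul_eq_mul, Finset.sum_sub_distrib,
    ← Finset.mul_sum]
  ring

end InnerProductSpace

section CentralLimit

variable {E X : Type*} [NormedAddCommGroup E] [NormedSpace ℝ E] [MeasurableSpace X]
  {vol : Measure X} {ℓ : E → X → ℝ} {S₁ : E → X → E →L[ℝ] ℝ} {S₂ : E → X → E →L[ℝ] E →L[ℝ] ℝ}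
  {b w : X → ℝ} {θ₀ : E} {r C : ℝ}

theorem integrable_norm_score_pow (h : RegularFamily vol ℓ S₁ S₂ b w θ₀ r C) {θ : E}
    (hθ : θ ∈ Metric.ball θ₀ r) {j : ℕ} (hj : j ≤ 3) :
    Integrable (fun x => ‖S₁ θ x‖ ^ j) (withLogDensity vol (ℓ θ)) := by
  refine h.integrable_of_norm_le hθ (K := 1)
    ((h.stronglyMeasurable₁ θ hθ).norm.pow j).aestronglyMeasurable hj fun x => ?_
  rw [norm_pow, norm_norm, one_mul]
  gcongr
  exact h.norm_le₁ θ hθ x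

theorem integral_norm_score_pow_three_le (h : RegularFamily vol ℓ S₁ S₂ b w θ₀ r C) {θ : E}
    (hθ : θ ∈ Metric.ball θ₀ r) :
    ∫ x, ‖S₁ θ x‖ ^ 3 ∂withLogDensity vol (ℓ θ) ≤ ∫ x, b x ^ 3 * w x ∂vol := by
  rw [integral_withLogDensity (h.measurable θ hθ)]
  refine integral_mono ((integrable_withLogDensity_iff (h.measurable θ hθ)).1
    (h.integrable_norm_score_pow hθ le_rfl)) h.integrable fun x => (Real.le_norm_self _).trans
      (h.norm_exp_smul_le hθ ?_)
  rw [norm_pow, norm_norm]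
  gcongr
  exact h.norm_le₁ θ hθ x

theorem tendsto_integral_score_apply_sq (h : RegularFamily vol ℓ S₁ S₂ b w θ₀ r C) (t : E) :
    Tendsto (fun θ => ∫ x, S₁ θ x t ^ 2 ∂withLogDensity vol (ℓ θ)) (𝓝 θ₀)
      (𝓝 (∫ x, S₁ θ₀ x t ^ 2 ∂withLogDensity vol (ℓ θ₀))) := by
  refine h.tendsto_integral (fun θ hθ => ?_) (fun x => ?_) (K := ‖t‖ ^ 2) (j := 2) (by norm_num)
    fun θ hθ x => ?_
  · exact ((h.stronglyMeasurable₁ θ hθ).aestronglyMeasurable.apply_continuousLinearMap t).pow 2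
  · exact ((h.hasFDerivAt' θ₀ h.mem_ball x).continuousAt.clm_apply continuousAt_const).pow 2
  · rw [norm_pow, ← mul_pow, mul_comm]
    gcongr
    exact (S₁ θ x).le_of_opNorm_le (h.norm_le₁ θ hθ x) t

theorem tendstoInDistribution_score {ι : Type*} [Fintype ι] [DecidableEq ι]
    {ℓ : EuclideanSpace ℝ ι → X → ℝ} {S₁ : EuclideanSpace ℝ ι → X → EuclideanSpace ℝ ι →L[ℝ] ℝ}
    {S₂ : EuclideanSpace ℝ ι → X → EuclideanSpace ℝ ι →L[ℝ] EuclideanSpace ℝ ι →L[ℝ] ℝ}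
    {θ₀ : EuclideanSpace ℝ ι} {P : ℕ → Measure X} [∀ n, IsProbabilityMeasure (P n)]
    {θ : ℕ → EuclideanSpace ℝ ι} {s : ℕ → X → EuclideanSpace ℝ ι} {Γ : Matrix ι ι ℝ}
    (h : RegularFamily vol ℓ S₁ S₂ b w θ₀ r C) (hθ : Tendsto θ atTop (𝓝 θ₀))
    (hP : ∀ n, P n = withLogDensity vol (ℓ (θ n))) (hmeas : ∀ n, Measurable (s n))
    (hs : ∀ n x, S₁ (θ n) x = innerSL ℝ (s n x)) (hΓ : Γ.PosSemidef)
    (hcov : ∀ t : EuclideanSpace ℝ ι,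
      t.ofLp ⬝ᵥ (Γ *ᵥ t.ofLp) = ∫ x, S₁ θ₀ x t ^ 2 ∂withLogDensity vol (ℓ θ₀)) :
    TendstoInDistribution (fun n (x : Fin n → X) => (√(n : ℝ))⁻¹ • ∑ i, s n (x i)) atTop id
      (fun n => Measure.pi fun _ : Fin n => P n) (multivariateGaussian 0 Γ) := by
  have hev := hθ (Metric.ball_mem_nhds θ₀ h.pos)
  have hnorm (n : ℕ) (x : X) : ‖s n x‖ = ‖S₁ (θ n) x‖ := by rw [hs, innerSL_apply_norm]
  have happly (n : ℕ) (x : X) (t : EuclideanSpace ℝ ι) : inner ℝ (s n x) t = S₁ (θ n) x t := by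
    rw [hs, innerSL_apply_apply]
  refine tendstoInDistribution_inv_sqrt_smul_sum (C := ∫ x, b x ^ 3 * w x ∂vol) P hmeas hΓ
    ?_ ?_ fun t => ?_
  · filter_upwards [hev] with n hn
    simp only [hnorm, hP]
    exact ⟨h.integrable_norm_score_pow hn le_rfl, h.integral_norm_score_pow_three_le hn⟩
  · filter_upwards [hev] with n hn t
    simp only [happly, hP]
    rw [← ContinuousLinearMap.integral_apply (h.integrable_score hn), h.integral_score hn,
      zero_apply]
  · simp only [happly, hP, hcov]
    exact (h.tendsto_integral_score_apply_sq t).comp hθ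

end CentralLimit

end RegularFamily

end Expansion

section SphericalIntegral

theorem lintegral_rpow_mul_exp_neg_mul_Ioi {a r : ℝ} (ha : 0 < a) (hr : 0 < r) :
    ∫⁻ t in Set.Ioi (0 : ℝ), ENNReal.ofReal (t ^ (a - 1) * Real.exp (-(r * t))) =
      ENNReal.ofReal (r ^ (-a) * Real.Gamma a) := by
  have h : ∫ t in Set.Ioi (0 : ℝ), t ^ (a - 1) * Real.exp (-(r * t)) = r ^ (-a) * Real.Gamma a := by
    rw [Real.integral_rpow_mul_exp_neg_mul_Ioi ha hr, one_div, Real.inv_rpow hr.le,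
      Real.rpow_neg hr.le]
  have := Real.Gamma_pos_of_pos ha
  rw [← h, ofReal_integral_eq_lintegral_ofReal (.of_integral_ne_zero (by rw [h]; positivity))]
  filter_upwards [self_mem_ae_restrict measurableSet_Ioi] with t ht
  have : (0 : ℝ) < t := ht
  positivity

variable {E : Type*} [NormedAddCommGroup E] [InnerProductSpace ℝ E] [FiniteDimensional ℝ E]
  [MeasurableSpace E] [BorelSpace E]

theorem lintegral_exp_neg_mul_norm_sq {c : ℝ} (hc : 0 < c) :
    ∫⁻ x : E, ENNReal.ofReal (Real.exp (-c * ‖x‖ ^ 2)) =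
      ENNReal.ofReal ((Real.pi / c) ^ ((Module.finrank ℝ E : ℝ) / 2)) := by
  have h := GaussianFourier.integral_rexp_neg_mul_sq_norm (V := E) hc
  rw [← h, ofReal_integral_eq_lintegral_ofReal (.of_integral_ne_zero (by rw [h]; positivity))]
  exact Eventually.of_forall fun x => (Real.exp_pos _).le

theorem lintegral_rpow_mul_exp_neg_one_add_mul_norm_sq {b t : ℝ} (hb : 0 < b) (ht : 0 < t)
    (s : ℝ) :
    ∫⁻ x : E, ENNReal.ofReal (t ^ (s - 1) * Real.exp (-((1 + b * ‖x‖ ^ 2) * t))) =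
      ENNReal.ofReal ((Real.pi / b) ^ ((Module.finrank ℝ E : ℝ) / 2)) *
        ENNReal.ofReal (t ^ (s - Module.finrank ℝ E / 2 - 1) * Real.exp (-(1 * t))) := by
  set d : ℝ := (Module.finrank ℝ E : ℝ) / 2
  have hfactor : ∀ x : E,
      ENNReal.ofReal (t ^ (s - 1) * Real.exp (-((1 + b * ‖x‖ ^ 2) * t))) =
        ENNReal.ofReal (t ^ (s - 1) * Real.exp (-(1 * t))) *
          ENNReal.ofReal (Real.exp (-(b * t) * ‖x‖ ^ 2)) := fun x => by
    rw [← ENNReal.ofReal_mul (by positivity), mul_assoc, ← Real.exp_add]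
    ring_nf
  have hpow : t ^ (s - 1) * (Real.pi / (b * t)) ^ d = (Real.pi / b) ^ d * t ^ (s - d - 1) := by
    rw [← div_div, Real.div_rpow (by positivity) ht.le,
      show s - 1 = s - d - 1 + d by ring, Real.rpow_add ht]
    field_simp
  simp_rw [hfactor]
  rw [lintegral_const_mul _ (by fun_prop), lintegral_exp_neg_mul_norm_sq (by positivity),
    ← ENNReal.ofReal_mul (by positivity), ← ENNReal.ofReal_mul (by positivity), mul_right_comm,
    hpow, mul_assoc]

-- `r ^ (-s)` is a mixture of the exponentials `exp (-(r * t))`, which turns the integrand into a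
-- mixture of Gaussian densities.
theorem lintegral_one_add_mul_norm_sq_rpow_neg {b s : ℝ} (hb : 0 < b)
    (hs : (Module.finrank ℝ E : ℝ) / 2 < s) :
    ∫⁻ x : E, ENNReal.ofReal ((1 + b * ‖x‖ ^ 2) ^ (-s)) =
      ENNReal.ofReal ((Real.pi / b) ^ ((Module.finrank ℝ E : ℝ) / 2) *
        Real.Gamma (s - Module.finrank ℝ E / 2) / Real.Gamma s) := by
  have hspos : 0 < s := lt_of_le_of_lt (by positivity) hs
  have hΓ := Real.Gamma_pos_of_pos hspos
  have hΓ0 : ENNReal.ofReal (Real.Gamma s) ≠ 0 := by simpa using hΓ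
  have hmix : ∀ x : E, ENNReal.ofReal ((1 + b * ‖x‖ ^ 2) ^ (-s)) * ENNReal.ofReal (Real.Gamma s) =
      ∫⁻ t in Set.Ioi (0 : ℝ),
        ENNReal.ofReal (t ^ (s - 1) * Real.exp (-((1 + b * ‖x‖ ^ 2) * t))) := fun x => by
    rw [lintegral_rpow_mul_exp_neg_mul_Ioi hspos (by positivity),
      ENNReal.ofReal_mul (by positivity)]
  rw [ENNReal.ofReal_div_of_pos hΓ, ENNReal.eq_div_iff hΓ0 ENNReal.ofReal_ne_top, mul_comm,
    ← lintegral_mul_const _ (by fun_prop)]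
  simp_rw [hmix]
  rw [lintegral_lintegral_swap (by fun_prop),
    setLIntegral_congr_fun measurableSet_Ioi fun t ht =>
      lintegral_rpow_mul_exp_neg_one_add_mul_norm_sq hb ht s,
    lintegral_const_mul _ (by fun_prop), lintegral_rpow_mul_exp_neg_mul_Ioi (sub_pos.2 hs) one_pos,
    Real.one_rpow, one_mul, ENNReal.ofReal_mul (by positivity)]

end SphericalIntegral

section Normalization

variable {k : ℕ}

open scoped MatrixOrder Matrix.Norms.L2Operator in
theorem exists_inv_eq_transpose_mul_self {S : Matrix (Fin k) (Fin k) ℝ} (hS : S.PosDef) :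
    ∃ B : Matrix (Fin k) (Fin k) ℝ, S⁻¹ = Bᵀ * B := by
  obtain ⟨B, hB⟩ := CStarAlgebra.nonneg_iff_eq_star_mul_self.mp hS.inv.posSemidef.nonneg
  exact ⟨B, by simpa [Matrix.star_eq_conjTranspose] using hB⟩

theorem mahalanobisSq_eq_norm_sq {S B : Matrix (Fin k) (Fin k) ℝ} (hB : S⁻¹ = Bᵀ * B)
    (μ x : EuclideanSpace ℝ (Fin k)) :
    mahalanobisSq μ S x = ‖Matrix.toLpLin 2 2 B (x - μ)‖ ^ 2 := by
  rw [mahalanobisSq, hB, EuclideanSpace.real_norm_sq_eq, ← Matrix.mulVec_mulVec,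
    Matrix.dotProduct_mulVec, Matrix.vecMul_transpose]
  simp [dotProduct, sq, Matrix.toLpLin_apply]

theorem lintegral_comp_mahalanobisSq {S : Matrix (Fin k) (Fin k) ℝ} (hS : S.PosDef)
    (μ : EuclideanSpace ℝ (Fin k)) {g : ℝ → ENNReal} (hg : Measurable g) :
    ∫⁻ x, g (mahalanobisSq μ S x) =
      ENNReal.ofReal (S.det ^ (1 / 2 : ℝ)) * ∫⁻ y : EuclideanSpace ℝ (Fin k), g (‖y‖ ^ 2) := by
  obtain ⟨B, hB⟩ := exists_inv_eq_transpose_mul_self hS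
  have hdet : B.det ^ 2 = S.det⁻¹ := by
    rw [← Ring.inverse_eq_inv', ← Matrix.det_nonsing_inv, hB, Matrix.det_mul,
      Matrix.det_transpose, sq]
  have hdet₀ : B.det ≠ 0 := pow_ne_zero_iff two_ne_zero |>.1 (hdet ▸ (inv_pos.2 hS.det_pos).ne')
  set T := Matrix.toLpLin 2 2 B
  have hT : LinearMap.det T = B.det := LinearMap.det_toLpLin 2 B
  have habs : |B.det⁻¹| = S.det ^ (1 / 2 : ℝ) := by
    rw [← Real.sqrt_eq_rpow, ← Real.sqrt_sq_eq_abs, inv_pow, hdet, inv_inv]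
  simp_rw [mahalanobisSq_eq_norm_sq hB]
  rw [lintegral_sub_right_eq_self (μ := volume) (fun x => g (‖T x‖ ^ 2)) μ,
    ← lintegral_map (μ := volume) (f := fun y => g (‖y‖ ^ 2)) (by fun_prop)
      (LinearMap.continuous_of_finiteDimensional T).measurable,
    Measure.map_linearMap_addHaar_eq_smul_addHaar volume (hT ▸ hdet₀), lintegral_smul_measure,
    hT, habs, smul_eq_mul]

theorem normConst_pos (k : ℕ) {ν : ℝ} (hν : 0 < ν) : 0 < normConst k ν := by
  have := Real.Gamma_pos_of_pos (show 0 < (ν + k) / 2 by positivity)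
  have := Real.Gamma_pos_of_pos (half_pos hν)
  unfold normConst
  positivity

theorem mahalanobisSq_nonneg {S : Matrix (Fin k) (Fin k) ℝ} (hS : S.PosDef)
    (μ x : EuclideanSpace ℝ (Fin k)) : 0 ≤ mahalanobisSq μ S x := by
  simpa only [star_trivial] using! hS.inv.posSemidef.dotProduct_mulVec_nonneg (x - μ).ofLp

theorem one_add_mahalanobisSq_div_pos {V : Triple k} (hV : V ∈ paramSpace k)
    (x : EuclideanSpace ℝ (Fin k)) : 0 < 1 + mahalanobisSq V.1 V.2.1 x / V.2.2 := by
  have := mahalanobisSq_nonneg hV.1 V.1 x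
  have := hV.2
  positivity

theorem density_pos {V : Triple k} (hV : V ∈ paramSpace k) (x : EuclideanSpace ℝ (Fin k)) :
    0 < density V x := by
  have := normConst_pos k hV.2
  have := hV.1.det_pos
  have := one_add_mahalanobisSq_div_pos hV x
  unfold density
  positivity

theorem log_density_eq {V : Triple k} (hV : V ∈ paramSpace k) (x : EuclideanSpace ℝ (Fin k)) :
    Real.log (density V x) = Real.log (normConst k V.2.2) - 1 / 2 * Real.log V.2.1.det -
      (V.2.2 + k) / 2 * Real.log (1 + mahalanobisSq V.1 V.2.1 x / V.2.2) := by
  have h₁ := normConst_pos k hV.2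
  have h₂ := hV.1.det_pos
  have h₃ := one_add_mahalanobisSq_div_pos hV x
  rw [density, Real.log_mul (by positivity) (by positivity),
    Real.log_mul (by positivity) (by positivity), Real.log_rpow h₂, Real.log_rpow h₃]
  ring

theorem lintegral_density {V : Triple k} (hV : V ∈ paramSpace k) :
    ∫⁻ x, ENNReal.ofReal (density V x) = 1 := by
  obtain ⟨μ, S, ν⟩ := V
  obtain ⟨hS, hν⟩ : S.PosDef ∧ 0 < ν := hV
  have hspherical := lintegral_one_add_mul_norm_sq_rpow_neg (E := EuclideanSpace ℝ (Fin k))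
    (inv_pos.2 hν) (s := (ν + k) / 2) (by rw [finrank_euclideanSpace_fin]; linarith)
  have hconst : (Real.pi / ν⁻¹) ^ ((k : ℝ) / 2) * Real.Gamma ((ν + k) / 2 - k / 2) /
      Real.Gamma ((ν + k) / 2) = (normConst k ν)⁻¹ := by
    rw [normConst, inv_div, div_inv_eq_mul, ← sub_div, add_sub_cancel_right]
  rw [finrank_euclideanSpace_fin, hconst] at hspherical
  have hc := normConst_pos k hν
  have hdet := hS.det_pos
  calc ∫⁻ x, ENNReal.ofReal (density (μ, S, ν) x)
      = ENNReal.ofReal (normConst k ν * S.det ^ (-(1 / 2 : ℝ))) * ∫⁻ x,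
          ENNReal.ofReal ((1 + ν⁻¹ * mahalanobisSq μ S x) ^ (-((ν + k) / 2))) := by
        rw [← lintegral_const_mul' _ _ ENNReal.ofReal_ne_top]
        refine lintegral_congr fun x => ?_
        rw [← ENNReal.ofReal_mul (by positivity), ← div_eq_inv_mul]
        rfl
    _ = 1 := by
        rw [lintegral_comp_mahalanobisSq hS μ
            (g := fun q => ENNReal.ofReal ((1 + ν⁻¹ * q) ^ (-((ν + k) / 2)))) (by fun_prop),
          hspherical, ← ENNReal.ofReal_mul (by positivity), ← ENNReal.ofReal_mul (by positivity),
          Real.rpow_neg hdet.le, ← ENNReal.ofReal_one]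
        congr 1
        field_simp

theorem isProbabilityMeasure_law {V : Triple k} (hV : V ∈ paramSpace k) :
    IsProbabilityMeasure (law V) :=
  ⟨by rw [law, withDensity_apply _ .univ, Measure.restrict_univ, lintegral_density hV]⟩

end Normalization

section Smoothness

variable {F ι : Type*} [NormedAddCommGroup F] [NormedSpace ℝ F] [Fintype ι] [DecidableEq ι]
  {n : WithTop ℕ∞} {p : F}

theorem contDiffAt_realGamma {s : ℝ} (hs : 0 < s) : ContDiffAt ℝ n Real.Gamma s := by
  have hopen : IsOpen {z : ℂ | 0 < z.re} := isOpen_lt continuous_const Complex.continuous_re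
  have hdiff : DifferentiableOn ℂ Complex.Gamma {z : ℂ | 0 < z.re} := by
    refine fun z (hz : 0 < z.re) =>
      (Complex.differentiableAt_Gamma z ?_).differentiableWithinAt
    rintro m rfl
    exact hz.not_ge (by simp)
  exact ((hdiff.contDiffOn hopen).contDiffAt
    (hopen.mem_nhds (show (0 : ℝ) < (s : ℂ).re by simpa using hs))).real_of_complex

theorem contDiffAt_normConst (k : ℕ) {ν : F → ℝ} (hν : ContDiffAt ℝ n ν p) (hp : 0 < ν p) :
    ContDiffAt ℝ n (fun q => normConst k (ν q)) p := by
  have hnum : ContDiffAt ℝ n (fun q => Real.Gamma ((ν q + k) / 2)) p :=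
    ContDiffAt.comp (g := Real.Gamma) p (contDiffAt_realGamma (by positivity))
      ((hν.add contDiffAt_const).div_const 2)
  have hden : ContDiffAt ℝ n (fun q => Real.Gamma (ν q / 2)) p :=
    ContDiffAt.comp (g := Real.Gamma) p (contDiffAt_realGamma (half_pos hp)) (hν.div_const 2)
  have hpow : ContDiffAt ℝ n (fun q => (Real.pi * ν q) ^ ((k : ℝ) / 2)) p :=
    (contDiffAt_const.mul hν).rpow_const_of_ne (by positivity)
  have := Real.Gamma_pos_of_pos (half_pos hp)
  exact hnum.div (hpow.mul hden) (by positivity)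

theorem contDiffAt_det {M : F → Matrix ι ι ℝ} (hM : ∀ i j, ContDiffAt ℝ n (fun q => M q i j) p) :
    ContDiffAt ℝ n (fun q => (M q).det) p := by
  simp only [Matrix.det_apply]
  exact ContDiffAt.sum fun σ _ => (contDiffAt_prod fun i _ => hM _ _).const_smul _

theorem contDiffAt_inv_apply {M : F → Matrix ι ι ℝ}
    (hM : ∀ i j, ContDiffAt ℝ n (fun q => M q i j) p) (hp : (M p).det ≠ 0) (i j : ι) :
    ContDiffAt ℝ n (fun q => (M q)⁻¹ i j) p := by
  simp only [Matrix.inv_def, Ring.inverse_eq_inv', Matrix.smul_apply, smul_eq_mul,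
    Matrix.adjugate_apply]
  refine ((contDiffAt_det hM).inv hp).mul (contDiffAt_det fun a b => ?_)
  simp only [Matrix.updateRow_apply]
  split_ifs
  · exact contDiffAt_const
  · exact hM a b

end Smoothness

section PosDef

variable {ι : Type*} [Fintype ι]

theorem posDef_iff_forall_sphere {M : Matrix ι ι ℝ} :
    M.PosDef ↔ M.IsSymm ∧ ∀ x ∈ Metric.sphere (0 : EuclideanSpace ℝ ι) 1,
      0 < x.ofLp ⬝ᵥ (M *ᵥ x.ofLp) := by
  rw [Matrix.posDef_iff_dotProduct_mulVec, Matrix.IsHermitian,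
    Matrix.conjTranspose_eq_transpose_of_trivial]
  refine and_congr_right fun _ => ⟨fun h x hx => ?_, fun h x hx => ?_⟩
  · have hx₀ : x.ofLp ≠ 0 := by
      rw [ne_eq, WithLp.ofLp_eq_zero]
      exact ne_zero_of_mem_unit_sphere ⟨x, hx⟩
    simpa only [star_trivial] using h hx₀
  · have hx₀ : 0 < ‖WithLp.toLp 2 x‖ := by simpa [norm_pos_iff] using hx
    have hunit := h (‖WithLp.toLp 2 x‖⁻¹ • WithLp.toLp 2 x) (by simp [norm_smul, hx₀.ne'])
    simp only [WithLp.ofLp_smul, Matrix.mulVec_smul, dotProduct_smul, smul_dotProduct,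
      smul_eq_mul] at hunit
    have hinv := inv_pos.2 hx₀
    simpa using pos_of_mul_pos_right (pos_of_mul_pos_right hunit hinv.le) hinv.le

theorem isOpen_setOf_posDef {ι X : Type*} [Finite ι] [TopologicalSpace X] {M : X → Matrix ι ι ℝ}
    (hM : Continuous M) (hsymm : ∀ x, (M x).IsSymm) : IsOpen {x | (M x).PosDef} := by
  have := Fintype.ofFinite ι
  rw [isOpen_iff_eventually]
  intro x₀ hx₀
  have hcont : Continuous fun p : X × EuclideanSpace ℝ ι =>
      p.2.ofLp ⬝ᵥ (M p.1 *ᵥ p.2.ofLp) := by fun_prop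
  have hpos : ∀ᶠ x in 𝓝 x₀, ∀ y ∈ Metric.sphere (0 : EuclideanSpace ℝ ι) 1,
      0 < y.ofLp ⬝ᵥ (M x *ᵥ y.ofLp) :=
    (isCompact_sphere _ _).eventually_forall_of_forall_eventually fun y hy =>
      (hcont.continuousAt (x := (x₀, y))).eventually
        (lt_mem_nhds ((posDef_iff_forall_sphere.1 hx₀).2 y hy))
  filter_upwards [hpos] with x hx using posDef_iff_forall_sphere.2 ⟨hsymm x, hx⟩

end PosDef

section Coordinates

variable {k : ℕ}

theorem isSymm_unvech (v : UpperIdx k → ℝ) : (unvech v).IsSymm := by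
  ext i j
  simp [unvech, min_comm, max_comm]

theorem isSymm_of_mem_paramSpace {V : Triple k} (hV : V ∈ paramSpace k) : V.2.1.IsSymm := by
  simpa [Matrix.IsHermitian, Matrix.IsSymm] using hV.1.isHermitian

theorem ofCoords_coords {V : Triple k} (hV : V.2.1.IsSymm) : ofCoords (coords V) = V := by
  refine Prod.ext rfl (Prod.ext ?_ rfl)
  ext i j
  change V.2.1 (min i j) (max i j) = V.2.1 i j
  rcases le_total i j with h | h
  · rw [min_eq_left h, max_eq_right h]
  · rw [min_eq_right h, max_eq_left h, hV.apply]

theorem coords_ofCoords (θ : EuclideanSpace ℝ (CoordIdx k)) : coords (ofCoords θ) = θ := by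
  ext i
  rcases i with i | ⟨⟨i, j⟩, hij : i ≤ j⟩ | i
  · rfl
  · simp [coords, vech, ofCoords, unvech, hij]
  · rfl

theorem coords_add_smul (V τ : Triple k) (c : ℝ) :
    coords (V + c • τ) = coords V + c • coords τ := by
  ext i
  rcases i with _ | _ | _ <;> simp [coords, vech]

theorem ofCoords_add_smul (θ v : EuclideanSpace ℝ (CoordIdx k)) (c : ℝ) :
    ofCoords (θ + c • v) = ofCoords θ + c • ofCoords v := by
  refine Prod.ext ?_ (Prod.ext ?_ (by simp [ofCoords])) <;> ext <;> simp [ofCoords, unvech]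

/-- The coordinate vectors of the parameters: the form of the parameter space that is an open subset
of a Euclidean space. -/
def coordSpace (k : ℕ) : Set (EuclideanSpace ℝ (CoordIdx k)) :=
  ofCoords ⁻¹' paramSpace k

theorem coords_mem_coordSpace {V : Triple k} (hV : V ∈ paramSpace k) :
    coords V ∈ coordSpace k := by
  rwa [coordSpace, Set.mem_preimage, ofCoords_coords (isSymm_of_mem_paramSpace hV)]

theorem contDiff_scatter_apply {n : WithTop ℕ∞} (i j : Fin k) :
    ContDiff ℝ n fun θ : EuclideanSpace ℝ (CoordIdx k) => (ofCoords θ).2.1 i j := by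
  simp only [ofCoords, unvech, Matrix.of_apply]
  fun_prop

/-- The coordinate `ν` as a linear form, whose multiples carry the unbounded part of the score. -/
noncomputable def tailForm (k : ℕ) : EuclideanSpace ℝ (CoordIdx k) →L[ℝ] ℝ :=
  EuclideanSpace.proj (Sum.inr (Sum.inr ()))

theorem tailForm_apply (θ : EuclideanSpace ℝ (CoordIdx k)) : tailForm k θ = (ofCoords θ).2.2 := rfl

theorem isOpen_coordSpace (k : ℕ) : IsOpen (coordSpace k) :=
  (isOpen_setOf_posDef
      (continuous_matrix fun i j => (contDiff_scatter_apply (n := 0) i j).continuous)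
      fun θ => isSymm_unvech fun p => θ (Sum.inr (Sum.inl p))).inter
    (isOpen_lt continuous_const (tailForm k).continuous)

end Coordinates

section PartialDerivative

variable {E Y G : Type*} [NormedAddCommGroup E] [NormedSpace ℝ E] [NormedAddCommGroup Y]
  [NormedSpace ℝ Y] [NormedAddCommGroup G] [NormedSpace ℝ G] {f : E × Y → G} {p : E × Y}
  {m n : WithTop ℕ∞}

/-- The partial derivative of a function on a product with respect to the first variable. -/
noncomputable def partialFDeriv (f : E × Y → G) (p : E × Y) : E →L[ℝ] G :=
  fderiv ℝ (fun θ => f (θ, p.2)) p.1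

theorem contDiffAt_partialFDeriv (hf : ContDiffAt ℝ n f p) (hmn : m + 1 ≤ n) :
    ContDiffAt ℝ m (partialFDeriv f) p :=
  ContDiffAt.fderiv (f := fun (q : E × Y) θ => f (θ, q.2))
    (ContDiffAt.comp (g := f) (p, p.1) hf (by fun_prop)) contDiffAt_fst hmn

theorem hasFDerivAt_partialFDeriv (hf : ContDiffAt ℝ n f p) (hn : n ≠ 0) :
    HasFDerivAt (fun θ => f (θ, p.2)) (partialFDeriv f p) p.1 :=
  (DifferentiableAt.comp (g := f) p.1 (hf.differentiableAt hn) (by fun_prop)).hasFDerivAt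

end PartialDerivative

section SphereProj

variable {E : Type*} [NormedAddCommGroup E]

theorem norm_one_prod (x : E) : ‖((1 : ℝ), x)‖ = max 1 ‖x‖ := by
  rw [Prod.norm_def, norm_one]

theorem norm_one_prod_pos (x : E) : 0 < ‖((1 : ℝ), x)‖ :=
  norm_pos_iff.2 fun h => one_ne_zero (congrArg Prod.fst h)

/-- The logarithm of the norm of `(1, x)`, the rate at which log-densities decrease. -/
noncomputable def logScale (x : E) : ℝ := Real.log ‖((1 : ℝ), x)‖

theorem logScale_nonneg (x : E) : 0 ≤ logScale x :=
  Real.log_nonneg ((le_max_left _ _).trans_eq (norm_one_prod x).symm)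

theorem continuous_logScale : Continuous (logScale (E := E)) :=
  Continuous.log (by fun_prop) fun x => (norm_one_prod_pos x).ne'

theorem continuous_norm_one_prod_rpow (s : ℝ) : Continuous fun x : E => ‖((1 : ℝ), x)‖ ^ s :=
  Continuous.rpow_const (by fun_prop) fun x => Or.inl (norm_one_prod_pos x).ne'

variable [NormedSpace ℝ E]

/-- The radial projection of `(1, x)` to the unit sphere of `ℝ × E`, which compactifies `E`. -/
noncomputable def sphereProj (x : E) : ℝ × E := ‖((1 : ℝ), x)‖⁻¹ • ((1 : ℝ), x)

theorem sphereProj_mem (x : E) : sphereProj x ∈ Metric.sphere (0 : ℝ × E) 1 := by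
  rw [mem_sphere_zero_iff_norm, sphereProj, norm_smul, norm_inv, norm_norm,
    inv_mul_cancel₀ (norm_one_prod_pos x).ne']

theorem continuous_sphereProj : Continuous (sphereProj (E := E)) :=
  Continuous.smul (Continuous.inv₀ (by fun_prop) fun x => (norm_one_prod_pos x).ne')
    (by fun_prop)

variable [FiniteDimensional ℝ E] [MeasurableSpace E] [BorelSpace E] {μ : Measure E}
  [μ.IsAddHaarMeasure]

theorem integrable_norm_one_prod_rpow_neg {s : ℝ} (hs : Module.finrank ℝ E < s) :
    Integrable (fun x : E => ‖((1 : ℝ), x)‖ ^ (-s)) μ := by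
  refine ((integrable_one_add_norm hs).const_mul (2 ^ s)).mono'
    (continuous_norm_one_prod_rpow _).aestronglyMeasurable (Eventually.of_forall fun x => ?_)
  have : 0 ≤ s := (Nat.cast_nonneg _).trans hs.le
  have hle : (1 + ‖x‖) / 2 ≤ ‖((1 : ℝ), x)‖ := by
    rw [norm_one_prod]
    linarith [le_max_left 1 ‖x‖, le_max_right 1 ‖x‖]
  calc ‖‖((1 : ℝ), x)‖ ^ (-s)‖ = ‖((1 : ℝ), x)‖ ^ (-s) := Real.norm_of_nonneg (by positivity)
    _ ≤ ((1 + ‖x‖) / 2) ^ (-s) := Real.rpow_le_rpow_of_nonpos (by positivity) hle (by linarith)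
    _ = 2 ^ s * (1 + ‖x‖) ^ (-s) := by
        rw [Real.div_rpow (by positivity) zero_le_two, Real.rpow_neg zero_le_two, div_inv_eq_mul,
          mul_comm]

theorem integrable_add_mul_logScale_pow_mul {a c s : ℝ} (ha : 0 ≤ a) (hc : 0 ≤ c)
    (hs : Module.finrank ℝ E < s) (j : ℕ) :
    Integrable (fun x : E => (a + c * logScale x) ^ j * ‖((1 : ℝ), x)‖ ^ (-s)) μ := by
  set ε : ℝ := (s - Module.finrank ℝ E) / (j + 1)
  have hε : 0 < ε := div_pos (sub_pos.2 hs) (by positivity)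
  have hεs : Module.finrank ℝ E < s - ε * j := by
    have : ε * (j + 1) = s - Module.finrank ℝ E := div_mul_cancel₀ _ (by positivity)
    linarith
  have hcont : Continuous fun x : E => (a + c * logScale x) ^ j * ‖((1 : ℝ), x)‖ ^ (-s) :=
    ((continuous_const.add (continuous_const.mul continuous_logScale)).pow j).mul
      (continuous_norm_one_prod_rpow _)
  refine ((integrable_norm_one_prod_rpow_neg hεs).const_mul ((a + c / ε) ^ j)).mono'
    hcont.aestronglyMeasurable (Eventually.of_forall fun x => ?_)
  have hN := norm_one_prod_pos x
  have hL := logScale_nonneg x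
  have hlog : a + c * logScale x ≤ (a + c / ε) * ‖((1 : ℝ), x)‖ ^ ε := by
    have h₁ : 1 ≤ ‖((1 : ℝ), x)‖ ^ ε :=
      Real.one_le_rpow ((le_max_left _ _).trans_eq (norm_one_prod x).symm) hε.le
    calc a + c * logScale x ≤ a * ‖((1 : ℝ), x)‖ ^ ε + c * (‖((1 : ℝ), x)‖ ^ ε / ε) := by
          gcongr
          · exact le_mul_of_one_le_right ha h₁
          · exact Real.log_le_rpow_div hN.le hε
      _ = (a + c / ε) * ‖((1 : ℝ), x)‖ ^ ε := by ring
  calc ‖(a + c * logScale x) ^ j * ‖((1 : ℝ), x)‖ ^ (-s)‖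
      = (a + c * logScale x) ^ j * ‖((1 : ℝ), x)‖ ^ (-s) := Real.norm_of_nonneg (by positivity)
    _ ≤ ((a + c / ε) * ‖((1 : ℝ), x)‖ ^ ε) ^ j * ‖((1 : ℝ), x)‖ ^ (-s) := by gcongr
    _ = (a + c / ε) ^ j * ‖((1 : ℝ), x)‖ ^ (-(s - ε * j)) := by
        rw [mul_pow, mul_assoc, ← Real.rpow_mul_natCast hN.le, ← Real.rpow_add hN, neg_sub,
          sub_eq_add_neg]

end SphereProj

section Homogenization

variable {k : ℕ} {θ : EuclideanSpace ℝ (CoordIdx k)} {y : ℝ × EuclideanSpace ℝ (Fin k)}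
  {n : WithTop ℕ∞} {p : EuclideanSpace ℝ (CoordIdx k) × (ℝ × EuclideanSpace ℝ (Fin k))}

/-- The homogenization of `1 + mahalanobisSq / ν`, a quadratic form on `ℝ × ℝ^k`. -/
noncomputable def homForm (θ : EuclideanSpace ℝ (CoordIdx k))
    (y : ℝ × EuclideanSpace ℝ (Fin k)) : ℝ :=
  y.1 ^ 2 + mahalanobisSq (y.1 • (ofCoords θ).1) (ofCoords θ).2.1 y.2 / (ofCoords θ).2.2

/-- The log-density as a function on `ℝ × ℝ^k`: its value at `x` is the value of this function at
`(1, x)`. -/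
noncomputable def homLogDensity
    (p : EuclideanSpace ℝ (CoordIdx k) × (ℝ × EuclideanSpace ℝ (Fin k))) : ℝ :=
  Real.log (normConst k (ofCoords p.1).2.2) - 1 / 2 * Real.log (ofCoords p.1).2.1.det -
    ((ofCoords p.1).2.2 + k) / 2 * Real.log (homForm p.1 p.2)

theorem homForm_smul (θ : EuclideanSpace ℝ (CoordIdx k)) (c : ℝ)
    (y : ℝ × EuclideanSpace ℝ (Fin k)) : homForm θ (c • y) = c ^ 2 * homForm θ y := by
  simp only [homForm, mahalanobisSq, Prod.smul_fst, Prod.smul_snd, smul_eq_mul, mul_smul,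
    ← smul_sub, WithLp.ofLp_smul, Matrix.mulVec_smul, dotProduct_smul, smul_dotProduct]
  ring

theorem homForm_pos (hθ : θ ∈ coordSpace k) (hy : y ≠ 0) : 0 < homForm θ y := by
  have hν := hθ.2
  have hQ := mahalanobisSq_nonneg hθ.1 (y.1 • (ofCoords θ).1) y.2
  unfold homForm
  rcases eq_or_ne y.1 0 with h | h
  · have hy₂ : y.2.ofLp ≠ 0 := by
      rw [ne_eq, WithLp.ofLp_eq_zero]
      exact fun h' => hy (Prod.ext h h')
    have : 0 < mahalanobisSq (y.1 • (ofCoords θ).1) (ofCoords θ).2.1 y.2 := by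
      simpa [mahalanobisSq, h] using hθ.1.inv.dotProduct_mulVec_pos hy₂
    positivity
  · positivity

theorem contDiffAt_homForm (hp : p.1 ∈ coordSpace k) :
    ContDiffAt ℝ n (fun q : _ × _ => homForm q.1 q.2) p := by
  have hcenter : ∀ i, ContDiffAt ℝ n
      (fun q : EuclideanSpace ℝ (CoordIdx k) × (ℝ × EuclideanSpace ℝ (Fin k)) =>
        (q.2.2 - q.2.1 • (ofCoords q.1).1).ofLp i) p := fun i => by
    simp only [ofCoords, WithLp.ofLp_sub, WithLp.ofLp_smul, Pi.sub_apply, Pi.smul_apply,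
      smul_eq_mul]
    fun_prop
  have hinv : ∀ i j, ContDiffAt ℝ n
      (fun q : EuclideanSpace ℝ (CoordIdx k) × (ℝ × EuclideanSpace ℝ (Fin k)) =>
        (ofCoords q.1).2.1⁻¹ i j) p := fun i j =>
    (contDiffAt_inv_apply (fun i j => (contDiff_scatter_apply i j).contDiffAt)
      hp.1.det_pos.ne' i j).comp p contDiffAt_fst
  simp only [homForm, mahalanobisSq, dotProduct, Matrix.mulVec]
  exact (contDiffAt_snd.fst.pow 2).add (ContDiffAt.div
    (ContDiffAt.sum fun i _ => (hcenter i).mul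
      (ContDiffAt.sum fun j _ => (hinv i j).mul (hcenter j)))
    ((tailForm k).contDiff.comp contDiff_fst).contDiffAt hp.2.ne')

theorem contDiffAt_homLogDensity (hp : p.1 ∈ coordSpace k) (hy : p.2 ≠ 0) :
    ContDiffAt ℝ n homLogDensity p := by
  have hν : ContDiffAt ℝ n
      (fun q : EuclideanSpace ℝ (CoordIdx k) × (ℝ × EuclideanSpace ℝ (Fin k)) =>
        (ofCoords q.1).2.2) p := ((tailForm k).contDiff.comp contDiff_fst).contDiffAt
  have hdet : ContDiffAt ℝ n
      (fun q : EuclideanSpace ℝ (CoordIdx k) × (ℝ × EuclideanSpace ℝ (Fin k)) =>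
        (ofCoords q.1).2.1.det) p :=
    (contDiffAt_det fun i j => (contDiff_scatter_apply i j).contDiffAt).comp p contDiffAt_fst
  exact (((contDiffAt_normConst k hν hp.2).log (normConst_pos k hp.2).ne').sub
    (contDiffAt_const.mul (hdet.log hp.1.det_pos.ne'))).sub
    (((hν.add contDiffAt_const).div_const 2).mul
      ((contDiffAt_homForm hp).log (homForm_pos hp hy).ne'))

theorem homLogDensity_smul (hθ : θ ∈ coordSpace k) (hy : y ≠ 0) {c : ℝ} (hc : c ≠ 0) :
    homLogDensity (θ, c • y) =
      homLogDensity (θ, y) - ((ofCoords θ).2.2 + k) * Real.log c := by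
  simp only [homLogDensity, homForm_smul]
  rw [Real.log_mul (pow_ne_zero 2 hc) (homForm_pos hθ hy).ne', Real.log_pow]
  push_cast
  ring

/-- The log-density as a function of the coordinate vector of the parameter. -/
noncomputable def logDensity (θ : EuclideanSpace ℝ (CoordIdx k)) (x : EuclideanSpace ℝ (Fin k)) :
    ℝ :=
  Real.log (density (ofCoords θ) x)

theorem logDensity_eq_homLogDensity_one (hθ : θ ∈ coordSpace k) (x : EuclideanSpace ℝ (Fin k)) :
    logDensity θ x = homLogDensity (θ, (1, x)) := by
  simp only [logDensity, log_density_eq hθ, homLogDensity, homForm, one_pow, one_smul]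

theorem logDensity_eq_homLogDensity_sphereProj (hθ : θ ∈ coordSpace k)
    (x : EuclideanSpace ℝ (Fin k)) :
    logDensity θ x = homLogDensity (θ, sphereProj x) - (tailForm k θ + k) * logScale x := by
  rw [sphereProj, homLogDensity_smul hθ (norm_pos_iff.1 (norm_one_prod_pos x))
    (inv_ne_zero (norm_one_prod_pos x).ne'), Real.log_inv, logDensity_eq_homLogDensity_one hθ,
    tailForm_apply, logScale]
  ring

theorem withLogDensity_logDensity (hθ : θ ∈ coordSpace k) :
    withLogDensity volume (logDensity θ) = law (ofCoords θ) := by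
  simp only [withLogDensity, logDensity, law, Real.exp_log (density_pos hθ _)]

theorem law_eq_withLogDensity {V : Triple k} (hV : V ∈ paramSpace k) :
    law V = withLogDensity volume (logDensity (coords V)) := by
  rw [withLogDensity_logDensity (coords_mem_coordSpace hV),
    ofCoords_coords (isSymm_of_mem_paramSpace hV)]

end Homogenization

section UniformOnCompact

variable {X Y G : Type*} [TopologicalSpace X] [TopologicalSpace Y] [SeminormedAddCommGroup G]
  {f : X × Y → G} {x₀ : X} {K : Set Y}

theorem eventually_forall_mem_norm_sub_le (hK : IsCompact K)
    (hf : ∀ y ∈ K, ContinuousAt f (x₀, y)) {ε : ℝ} (hε : 0 < ε) :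
    ∀ᶠ x in 𝓝 x₀, ∀ y ∈ K, ‖f (x, y) - f (x₀, y)‖ ≤ ε := by
  refine hK.eventually_forall_of_forall_eventually fun y hy => ?_
  have hf₀ : ContinuousAt (fun p : X × Y => f (x₀, p.2)) (x₀, y) :=
    ContinuousAt.comp (g := f) (hf y hy) (by fun_prop)
  have hlim : Tendsto (fun p : X × Y => ‖f p - f (x₀, p.2)‖) (𝓝 (x₀, y)) (𝓝 0) := by
    simpa using ((hf y hy).sub hf₀).norm.tendsto
  exact (hlim.eventually (gt_mem_nhds hε)).mono fun p hp => hp.le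

theorem exists_eventually_forall_mem_norm_le (hK : IsCompact K)
    (hf : ∀ y ∈ K, ContinuousAt f (x₀, y)) :
    ∃ M, ∀ᶠ x in 𝓝 x₀, ∀ y ∈ K, ‖f (x, y)‖ ≤ M := by
  obtain ⟨M, hM⟩ := hK.exists_bound_of_continuousOn (f := fun y => f (x₀, y)) fun y hy =>
    (ContinuousAt.comp (g := f) (hf y hy) (by fun_prop)).continuousWithinAt
  refine ⟨M + 1, (eventually_forall_mem_norm_sub_le hK hf one_pos).mono fun x hx y hy => ?_⟩
  linarith [norm_le_norm_add_norm_sub' (f (x, y)) (f (x₀, y)), hM y hy, hx y hy]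

end UniformOnCompact

section Score

variable {k : ℕ} {θ θ₀ : EuclideanSpace ℝ (CoordIdx k)}

set_option maxSynthPendingDepth 3

/-- The derivative of the log-density at `x` with respect to the coordinate vector of the
parameter, see `hasFDerivAt_logDensity`. -/
noncomputable def scoreForm (θ : EuclideanSpace ℝ (CoordIdx k)) (x : EuclideanSpace ℝ (Fin k)) :
    EuclideanSpace ℝ (CoordIdx k) →L[ℝ] ℝ :=
  partialFDeriv homLogDensity (θ, sphereProj x) - logScale x • tailForm k

/-- The second derivative of the log-density at `x` with respect to the coordinate vector of the
parameter, see `hasFDerivAt_scoreForm`. -/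
noncomputable def hessForm (θ : EuclideanSpace ℝ (CoordIdx k)) (x : EuclideanSpace ℝ (Fin k)) :
    EuclideanSpace ℝ (CoordIdx k) →L[ℝ] EuclideanSpace ℝ (CoordIdx k) →L[ℝ] ℝ :=
  partialFDeriv (partialFDeriv homLogDensity) (θ, sphereProj x)

section Sphere

variable {y : ℝ × EuclideanSpace ℝ (Fin k)} {n : WithTop ℕ∞}

theorem contDiffAt_homLogDensity_of_mem_sphere (hθ : θ ∈ coordSpace k)
    (hy : y ∈ Metric.sphere (0 : ℝ × EuclideanSpace ℝ (Fin k)) 1) :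
    ContDiffAt ℝ n homLogDensity (θ, y) :=
  contDiffAt_homLogDensity hθ (ne_zero_of_mem_unit_sphere ⟨y, hy⟩)

theorem contDiffAt_partialFDeriv_homLogDensity (hθ : θ ∈ coordSpace k)
    (hy : y ∈ Metric.sphere (0 : ℝ × EuclideanSpace ℝ (Fin k)) 1) :
    ContDiffAt ℝ n (partialFDeriv homLogDensity) (θ, y) :=
  contDiffAt_partialFDeriv (contDiffAt_homLogDensity_of_mem_sphere hθ hy) le_rfl

theorem contDiffAt_partialFDeriv_partialFDeriv_homLogDensity (hθ : θ ∈ coordSpace k)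
    (hy : y ∈ Metric.sphere (0 : ℝ × EuclideanSpace ℝ (Fin k)) 1) :
    ContDiffAt ℝ n (partialFDeriv (partialFDeriv (homLogDensity (k := k)))) (θ, y) :=
  contDiffAt_partialFDeriv (contDiffAt_partialFDeriv_homLogDensity hθ hy) le_rfl

end Sphere

theorem hasFDerivAt_logDensity (hθ : θ ∈ coordSpace k) (x : EuclideanSpace ℝ (Fin k)) :
    HasFDerivAt (fun θ => logDensity θ x) (scoreForm θ x) θ := by
  have hsphere := hasFDerivAt_partialFDeriv
    (contDiffAt_homLogDensity_of_mem_sphere (n := 1) hθ (sphereProj_mem x)) one_ne_zero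
  refine (hsphere.sub (((tailForm k).hasFDerivAt.add_const (k : ℝ)).mul_const (logScale x)))
    |>.congr_of_eventuallyEq ?_
  filter_upwards [(isOpen_coordSpace k).mem_nhds hθ] with η hη
    using logDensity_eq_homLogDensity_sphereProj hη x

theorem hasFDerivAt_scoreForm (hθ : θ ∈ coordSpace k) (x : EuclideanSpace ℝ (Fin k)) :
    HasFDerivAt (fun θ => scoreForm θ x) (hessForm θ x) θ :=
  (hasFDerivAt_partialFDeriv (contDiffAt_partialFDeriv_homLogDensity (n := 1) hθ
    (sphereProj_mem x)) one_ne_zero).sub_const _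

theorem continuous_logDensity (hθ : θ ∈ coordSpace k) : Continuous (logDensity θ) := by
  simp only [funext (logDensity_eq_homLogDensity_one hθ)]
  refine continuous_iff_continuousAt.2 fun x => ContinuousAt.comp (g := homLogDensity)
    (contDiffAt_homLogDensity (n := 0) hθ ?_).continuousAt (by fun_prop)
  exact norm_pos_iff.1 (norm_one_prod_pos x)

theorem continuous_scoreForm (hθ : θ ∈ coordSpace k) : Continuous (scoreForm θ) := by
  refine Continuous.sub (continuous_iff_continuousAt.2 fun x => ?_)
    (continuous_logScale.smul continuous_const)
  exact ContinuousAt.comp (g := partialFDeriv homLogDensity)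
    (contDiffAt_partialFDeriv_homLogDensity (n := 0) hθ (sphereProj_mem x)).continuousAt
    (continuousAt_const.prodMk continuous_sphereProj.continuousAt)

theorem continuous_hessForm (hθ : θ ∈ coordSpace k) : Continuous (hessForm θ) :=
  continuous_iff_continuousAt.2 fun x =>
    ContinuousAt.comp (g := partialFDeriv (partialFDeriv homLogDensity))
      (contDiffAt_partialFDeriv_partialFDeriv_homLogDensity (n := 0) hθ
        (sphereProj_mem x)).continuousAt
      (continuousAt_const.prodMk continuous_sphereProj.continuousAt)

theorem score_eq_toDual_symm {V : Triple k} (hV : V ∈ paramSpace k)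
    (x : EuclideanSpace ℝ (Fin k)) :
    score V x = (InnerProductSpace.toDual ℝ _).symm (scoreForm (coords V) x) :=
  (hasFDerivAt_logDensity (coords_mem_coordSpace hV) x).hasGradientAt.gradient

theorem innerSL_score {V : Triple k} (hV : V ∈ paramSpace k) (x : EuclideanSpace ℝ (Fin k)) :
    innerSL ℝ (score V x) = scoreForm (coords V) x := by
  rw [score_eq_toDual_symm hV]
  exact (InnerProductSpace.toDual ℝ _).apply_symm_apply _

theorem continuous_score {V : Triple k} (hV : V ∈ paramSpace k) : Continuous (score V) := by
  simp only [funext (score_eq_toDual_symm hV)]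
  exact (LinearIsometryEquiv.continuous _).comp
    (continuous_scoreForm (coords_mem_coordSpace hV))

theorem exp_logDensity_le {M t : ℝ} (hθ : θ ∈ coordSpace k) (ht : t ≤ tailForm k θ)
    (hM : ∀ y ∈ Metric.sphere (0 : ℝ × EuclideanSpace ℝ (Fin k)) 1, ‖homLogDensity (θ, y)‖ ≤ M)
    (x : EuclideanSpace ℝ (Fin k)) :
    Real.exp (logDensity θ x) ≤ Real.exp M * ‖((1 : ℝ), x)‖ ^ (-(t + k)) := by
  rw [logDensity_eq_homLogDensity_sphereProj hθ, Real.rpow_def_of_pos (norm_one_prod_pos x),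
    ← Real.exp_add, Real.exp_le_exp]
  have hL := mul_le_mul_of_nonneg_right ht (logScale_nonneg x)
  have hH := (Real.le_norm_self _).trans (hM _ (sphereProj_mem x))
  change _ ≤ M + logScale x * -(t + k)
  linarith

theorem norm_scoreForm_le {M : ℝ}
    (hM : ∀ y ∈ Metric.sphere (0 : ℝ × EuclideanSpace ℝ (Fin k)) 1,
      ‖partialFDeriv homLogDensity (θ, y)‖ ≤ M) (x : EuclideanSpace ℝ (Fin k)) :
    ‖scoreForm θ x‖ ≤ M + ‖tailForm k‖ * logScale x := by
  refine (norm_sub_le _ _).trans (add_le_add (hM _ (sphereProj_mem x)) ?_)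
  rw [norm_smul, Real.norm_of_nonneg (logScale_nonneg x), mul_comm]

theorem exists_eventually_bounds (hθ₀ : θ₀ ∈ coordSpace k) :
    ∃ M, 0 ≤ M ∧ ∀ᶠ θ in 𝓝 θ₀, θ ∈ coordSpace k ∧ tailForm k θ₀ / 2 ≤ tailForm k θ ∧
      ∀ y ∈ Metric.sphere (0 : ℝ × EuclideanSpace ℝ (Fin k)) 1, ‖homLogDensity (θ, y)‖ ≤ M ∧
        ‖partialFDeriv homLogDensity (θ, y)‖ ≤ M ∧
        ‖partialFDeriv (partialFDeriv homLogDensity) (θ, y)‖ ≤ M := by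
  obtain ⟨M₀, h₀⟩ := exists_eventually_forall_mem_norm_le (isCompact_sphere _ 1) fun y hy =>
    (contDiffAt_homLogDensity_of_mem_sphere (n := 0) hθ₀ hy).continuousAt
  obtain ⟨M₁, h₁⟩ := exists_eventually_forall_mem_norm_le (isCompact_sphere _ 1) fun y hy =>
    (contDiffAt_partialFDeriv_homLogDensity (n := 0) hθ₀ hy).continuousAt
  obtain ⟨M₂, h₂⟩ := exists_eventually_forall_mem_norm_le (isCompact_sphere _ 1) fun y hy =>
    (contDiffAt_partialFDeriv_partialFDeriv_homLogDensity (n := 0) hθ₀ hy).continuousAt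
  have htail : ∀ᶠ θ in 𝓝 θ₀, tailForm k θ₀ / 2 < tailForm k θ :=
    (tailForm k).continuous.continuousAt.eventually (lt_mem_nhds (half_lt_self hθ₀.2))
  refine ⟨max 0 (max M₀ (max M₁ M₂)), le_max_left _ _, ?_⟩
  filter_upwards [h₀, h₁, h₂, htail, (isOpen_coordSpace k).mem_nhds hθ₀]
    with θ h₀ h₁ h₂ htail hθ
  refine ⟨hθ, htail.le, fun y hy => ?_⟩
  simp only [le_max_iff]
  exact ⟨.inr (.inl (h₀ y hy)), .inr (.inr (.inl (h₁ y hy))), .inr (.inr (.inr (h₂ y hy)))⟩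

theorem eventually_forall_norm_hessForm_sub_le (hθ₀ : θ₀ ∈ coordSpace k) {ε : ℝ} (hε : 0 < ε) :
    ∀ᶠ θ in 𝓝 θ₀, ∀ x, ‖hessForm θ x - hessForm θ₀ x‖ ≤ ε :=
  (eventually_forall_mem_norm_sub_le (isCompact_sphere _ 1) (fun _ hy =>
    (contDiffAt_partialFDeriv_partialFDeriv_homLogDensity (n := 0) hθ₀ hy).continuousAt)
    hε).mono fun _ hθ x => hθ _ (sphereProj_mem x)

theorem exists_regularFamily (hθ₀ : θ₀ ∈ coordSpace k) :
    ∃ b w r C, RegularFamily volume logDensity scoreForm hessForm b w θ₀ r C := by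
  obtain ⟨M, hM, hev⟩ := exists_eventually_bounds hθ₀
  obtain ⟨r, hr, hball⟩ := Metric.eventually_nhds_iff_ball.1 hev
  have hν : 0 < tailForm k θ₀ := hθ₀.2
  have hs : (Module.finrank ℝ (EuclideanSpace ℝ (Fin k)) : ℝ) < tailForm k θ₀ / 2 + k := by
    rw [finrank_euclideanSpace_fin]
    linarith
  refine ⟨fun x => 1 + M + ‖tailForm k‖ * logScale x,
    fun x => Real.exp M * ‖((1 : ℝ), x)‖ ^ (-(tailForm k θ₀ / 2 + k)), r, M, ?_⟩
  have hb : Continuous fun x : EuclideanSpace ℝ (Fin k) => 1 + M + ‖tailForm k‖ * logScale x :=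
    continuous_const.add (continuous_const.mul continuous_logScale)
  have hw : Continuous fun x : EuclideanSpace ℝ (Fin k) =>
      Real.exp M * ‖((1 : ℝ), x)‖ ^ (-(tailForm k θ₀ / 2 + k)) :=
    continuous_const.mul (continuous_norm_one_prod_rpow _)
  exact
    { pos := hr
      hasFDerivAt := fun θ hθ => hasFDerivAt_logDensity (hball θ hθ).1
      hasFDerivAt' := fun θ hθ => hasFDerivAt_scoreForm (hball θ hθ).1
      measurable := fun θ hθ => (continuous_logDensity (hball θ hθ).1).measurable
      stronglyMeasurable₁ := fun θ hθ => (continuous_scoreForm (hball θ hθ).1).stronglyMeasurable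
      stronglyMeasurable₂ := fun θ hθ => (continuous_hessForm (hball θ hθ).1).stronglyMeasurable
      measurable_b := hb.measurable
      measurable_w := hw.measurable
      exp_le := fun θ hθ => exp_logDensity_le (hball θ hθ).1 (hball θ hθ).2.1
        fun y hy => ((hball θ hθ).2.2 y hy).1
      norm_le₁ := fun θ hθ x => by
        linarith [norm_scoreForm_le (fun y hy => ((hball θ hθ).2.2 y hy).2.1) x]
      norm_le₂ := fun θ hθ x => ((hball θ hθ).2.2 _ (sphereProj_mem x)).2.2
      one_le := fun x => by
        have := mul_nonneg (norm_nonneg (tailForm k)) (logScale_nonneg x)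
        linarith
      integrable := by
        simpa only [mul_left_comm] using (integrable_add_mul_logScale_pow_mul (by positivity)
          (norm_nonneg (tailForm k)) hs 3).const_mul (Real.exp M)
      equicontinuous := fun ε hε => eventually_forall_norm_hessForm_sub_le hθ₀ hε
      isProbabilityMeasure := fun θ hθ => by
        rw [withLogDensity_logDensity (hball θ hθ).1]
        exact isProbabilityMeasure_law (hball θ hθ).1 }

end Score

section MatrixInverse

variable {ι : Type*} [Fintype ι] [DecidableEq ι]

attribute [local instance] Matrix.linftyOpNormedRing Matrix.linftyOpNormedAlgebra in
theorem hasDerivAt_dotProduct_inv_mulVec {S : Matrix ι ι ℝ} (T : Matrix ι ι ℝ) (hS : IsUnit S)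
    (u w : ι → ℝ) :
    HasDerivAt (fun t : ℝ => u ⬝ᵥ ((S + t • T)⁻¹ *ᵥ w)) (-(u ⬝ᵥ ((S⁻¹ * T * S⁻¹) *ᵥ w))) 0 := by
  obtain ⟨S, rfl⟩ := hS
  have hline : HasDerivAt (fun t : ℝ => (S : Matrix ι ι ℝ) + t • T) T 0 := by
    have := ((hasDerivAt_id (0 : ℝ)).smul_const T).const_add (S : Matrix ι ι ℝ)
    rwa [one_smul] at this
  have hinv : HasDerivAt (fun t : ℝ => ((S : Matrix ι ι ℝ) + t • T)⁻¹)
      (-((S : Matrix ι ι ℝ)⁻¹ * T * (S : Matrix ι ι ℝ)⁻¹)) 0 := by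
    simp only [Matrix.nonsing_inv_eq_ringInverse]
    convert! (hasFDerivAt_ringInverse (𝕜 := ℝ) S).comp_hasDerivAt_of_eq (0 : ℝ) hline (by simp)
      using 1
    simp
  have hL := (dotProductEquiv ℝ ι u ∘ₗ (Matrix.mulVecBilin ℝ ℝ).flip
    w).toContinuousLinearMap.hasFDerivAt.comp_hasDerivAt (0 : ℝ) hinv
  rw [← dotProduct_neg, ← Matrix.neg_mulVec]
  exact hL

theorem eq_zero_of_isSymm_of_forall_dotProduct_mulVec_eq_zero {ι : Type*} [Fintype ι]
    {T : Matrix ι ι ℝ} (hT : T.IsSymm) (h : ∀ w, w ⬝ᵥ (T *ᵥ w) = 0) : T = 0 := by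
  classical
  have hsymm : (Matrix.toEuclideanLin T).IsSymmetric :=
    Matrix.isSymmetric_toEuclideanLin_iff.2
      ((Matrix.conjTranspose_eq_transpose_of_trivial T).trans hT)
  rw [← Matrix.toEuclideanLin.map_eq_zero_iff, ← hsymm.inner_map_self_eq_zero]
  intro x
  simpa [Matrix.toLpLin_apply, EuclideanSpace.inner_eq_star_dotProduct] using h x.ofLp

theorem eq_zero_of_forall_two_mul_add_eq_zero {S T : Matrix ι ι ℝ} {m : ι → ℝ} (hS : S.PosDef)
    (hT : T.IsSymm)
    (h : ∀ z, 2 * (m ⬝ᵥ (S⁻¹ *ᵥ z)) + z ⬝ᵥ ((S⁻¹ * T * S⁻¹) *ᵥ z) = 0) : m = 0 ∧ T = 0 := by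
  have hodd : m ⬝ᵥ (S⁻¹ *ᵥ m) = 0 := by
    have h₁ := h m
    have h₂ := h (-m)
    simp only [Matrix.mulVec_neg, dotProduct_neg, neg_dotProduct, neg_neg] at h₂
    linarith
  have hm : m = 0 := by
    by_contra hm
    exact (hS.inv.dotProduct_mulVec_pos hm).ne' (by rwa [star_trivial])
  refine ⟨hm, eq_zero_of_isSymm_of_forall_dotProduct_mulVec_eq_zero hT fun w => ?_⟩
  have hdet : IsUnit S.det := hS.isUnit.map Matrix.detMonoidHom
  have hw := h (S *ᵥ w)
  have hSw : S *ᵥ w = w ᵥ* S := by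
    rw [← Matrix.vecMul_transpose, show Sᵀ = S by simpa using hS.isHermitian.eq]
  rwa [hm, zero_dotProduct, mul_zero, zero_add, Matrix.mulVec_mulVec,
    Matrix.nonsing_inv_mul_cancel_right _ _ hdet, hSw, ← Matrix.dotProduct_mulVec,
    Matrix.mulVec_mulVec, Matrix.mul_nonsing_inv_cancel_left _ _ hdet] at hw

end MatrixInverse

section Nondegeneracy

variable {k : ℕ} {θ v : EuclideanSpace ℝ (CoordIdx k)}

theorem exists_lt_logScale {E : Type*} [NormedAddCommGroup E] [NormedSpace ℝ E] [Nontrivial E]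
    (c : ℝ) : ∃ x : E, c < logScale x := by
  obtain ⟨x, hx⟩ := NormedSpace.exists_lt_norm ℝ E (Real.exp c)
  refine ⟨x, (Real.lt_log_iff_exp_lt (norm_one_prod_pos x)).2 (hx.trans_le ?_)⟩
  exact (le_max_right _ _).trans_eq (norm_one_prod x).symm

theorem tailForm_eq_zero_of_forall_scoreForm_eq_zero (hk : 0 < k) (hθ : θ ∈ coordSpace k)
    (hv : ∀ x, scoreForm θ x v = 0) : tailForm k v = 0 := by
  obtain ⟨M, -, hev⟩ := exists_eventually_bounds hθ
  have hbound := fun x => (hev.self_of_nhds.2.2 _ (sphereProj_mem x)).2.1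
  have : Nonempty (Fin k) := ⟨⟨0, hk⟩⟩
  by_contra hne
  obtain ⟨x, hx⟩ := exists_lt_logScale (E := EuclideanSpace ℝ (Fin k)) (M * ‖v‖ / |tailForm k v|)
  rw [div_lt_iff₀ (abs_pos.2 hne)] at hx
  refine hx.not_ge ?_
  have hx₀ : partialFDeriv homLogDensity (θ, sphereProj x) v = logScale x * tailForm k v := by
    simpa [scoreForm, sub_eq_zero] using hv x
  calc logScale x * |tailForm k v| = ‖partialFDeriv homLogDensity (θ, sphereProj x) v‖ := by
        rw [hx₀, norm_mul, Real.norm_of_nonneg (logScale_nonneg x), Real.norm_eq_abs]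
    _ ≤ M * ‖v‖ := ContinuousLinearMap.le_of_opNorm_le _ (hbound x) v

theorem hasDerivAt_mahalanobisSq (μ m z : EuclideanSpace ℝ (Fin k))
    {S T : Matrix (Fin k) (Fin k) ℝ} (hS : S.PosDef) :
    HasDerivAt (fun t : ℝ => mahalanobisSq (μ + t • m) (S + t • T) (μ + z))
      (-(2 * (m.ofLp ⬝ᵥ (S⁻¹ *ᵥ z.ofLp)) + z.ofLp ⬝ᵥ ((S⁻¹ * T * S⁻¹) *ᵥ z.ofLp))) 0 := by
  have hder := hasDerivAt_dotProduct_inv_mulVec T hS.isUnit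
  have hid := hasDerivAt_id (0 : ℝ)
  have hexpand : (fun t : ℝ => mahalanobisSq (μ + t • m) (S + t • T) (μ + z)) = fun t =>
      z.ofLp ⬝ᵥ ((S + t • T)⁻¹ *ᵥ z.ofLp) - t * (m.ofLp ⬝ᵥ ((S + t • T)⁻¹ *ᵥ z.ofLp)) -
        t * (z.ofLp ⬝ᵥ ((S + t • T)⁻¹ *ᵥ m.ofLp)) +
        t * (t * (m.ofLp ⬝ᵥ ((S + t • T)⁻¹ *ᵥ m.ofLp))) := by
    ext t
    simp only [mahalanobisSq, add_sub_add_left_eq_sub, WithLp.ofLp_sub, WithLp.ofLp_smul,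
      Matrix.mulVec_sub, Matrix.mulVec_smul, dotProduct_sub, sub_dotProduct, dotProduct_smul,
      smul_dotProduct, smul_eq_mul]
    ring
  have hsymm : z.ofLp ⬝ᵥ (S⁻¹ *ᵥ m.ofLp) = m.ofLp ⬝ᵥ (S⁻¹ *ᵥ z.ofLp) := by
    rw [Matrix.dotProduct_mulVec, ← Matrix.mulVec_transpose, dotProduct_comm,
      show S⁻¹ᵀ = S⁻¹ by simpa using hS.inv.isHermitian.eq]
  rw [hexpand]
  convert! (((hder z z).sub (hid.mul (hder m z))).sub (hid.mul (hder z m))).add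
    (hid.mul (hid.mul (hder m m))) using 1
  simp only [Pi.mul_apply, id_eq, zero_smul, add_zero, hsymm]
  ring

theorem exists_forall_scoreForm_apply_eq {μ m : EuclideanSpace ℝ (Fin k)}
    {S T : Matrix (Fin k) (Fin k) ℝ} {ν : ℝ} (hθ : θ ∈ coordSpace k)
    (hV : ofCoords θ = (μ, S, ν)) (hv : ofCoords v = (m, T, 0)) :
    ∃ d : ℝ, ∀ z, scoreForm θ (μ + z) v = d + (ν + k) / 2 *
      ((2 * (m.ofLp ⬝ᵥ (S⁻¹ *ᵥ z.ofLp)) + z.ofLp ⬝ᵥ ((S⁻¹ * T * S⁻¹) *ᵥ z.ofLp)) / ν /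
        (1 + mahalanobisSq μ S (μ + z) / ν)) := by
  have hpath (t : ℝ) : ofCoords (θ + t • v) = (μ + t • m, S + t • T, ν) := by
    rw [ofCoords_add_smul, hV, hv]
    simp
  have hVmem : (μ, S, ν) ∈ paramSpace k := hV ▸ hθ
  have hline : HasDerivAt (fun t : ℝ => θ + t • v) v 0 := by
    simpa using ((hasDerivAt_id (0 : ℝ)).smul_const v).const_add θ
  have hmem : ∀ᶠ t : ℝ in 𝓝 0, θ + t • v ∈ coordSpace k :=
    hline.continuousAt.eventually ((isOpen_coordSpace k).mem_nhds (by simpa using hθ))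
  have hdet : DifferentiableAt ℝ (fun t : ℝ => Real.log (S + t • T).det) 0 :=
    ((contDiffAt_det fun i j => by
      simp only [Matrix.add_apply, Matrix.smul_apply, smul_eq_mul]
      fun_prop).log (by simpa using hVmem.1.det_pos.ne')).differentiableAt one_ne_zero
  refine ⟨-(1 / 2 * deriv (fun t : ℝ => Real.log (S + t • T).det) 0), fun z => ?_⟩
  have hscore : HasDerivAt (fun t : ℝ => logDensity (θ + t • v) (μ + z))
      (scoreForm θ (μ + z) v) 0 :=
    (hasFDerivAt_logDensity hθ _).comp_hasDerivAt_of_eq (0 : ℝ) hline (by simp)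
  have hquad := (((hasDerivAt_mahalanobisSq μ m z (T := T) hVmem.1).div_const ν).const_add 1).log
    (by simpa using (one_add_mahalanobisSq_div_pos hVmem (μ + z)).ne')
  have hexplicit := ((hdet.hasDerivAt.const_mul (1 / 2)).const_sub
    (Real.log (normConst k ν))).sub (hquad.const_mul ((ν + k) / 2))
  refine (hscore.unique (hexplicit.congr_of_eventuallyEq ?_)).trans ?_
  · filter_upwards [hmem] with t ht
    rw [logDensity, log_density_eq ht, hpath]
    rfl
  · simp only [zero_smul, add_zero]
    ring

theorem eq_zero_of_forall_scoreForm_eq_zero (hk : 0 < k) (hθ : θ ∈ coordSpace k)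
    (hscore : ∀ x, scoreForm θ x v = 0) : v = 0 := by
  have htail := tailForm_eq_zero_of_forall_scoreForm_eq_zero hk hθ hscore
  obtain ⟨⟨μ, S, ν⟩, hV⟩ : ∃ V, ofCoords θ = V := ⟨_, rfl⟩
  obtain ⟨⟨m, T, c⟩, hv⟩ : ∃ τ, ofCoords v = τ := ⟨_, rfl⟩
  obtain rfl : c = 0 := by simpa [tailForm_apply, hv] using htail
  have hVmem : (μ, S, ν) ∈ paramSpace k := hV ▸ hθ
  have hν : 0 < ν := hVmem.2
  have hT : (ofCoords v).2.1.IsSymm := isSymm_unvech fun p => v (Sum.inr (Sum.inl p))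
  rw [hv] at hT
  obtain ⟨d, hd⟩ := exists_forall_scoreForm_apply_eq hθ hV hv
  simp only [hscore] at hd
  have hd₀ : d = 0 := by simpa using (hd 0).symm
  obtain ⟨hm₀, rfl⟩ := eq_zero_of_forall_two_mul_add_eq_zero (m := m.ofLp) hVmem.1 hT fun z => by
    have hpos := one_add_mahalanobisSq_div_pos hVmem (μ + WithLp.toLp 2 z)
    have hz := hd (WithLp.toLp 2 z)
    rwa [hd₀, zero_add, eq_comm, mul_eq_zero, or_iff_right (by positivity), div_eq_zero_iff,
      or_iff_left hpos.ne', div_eq_zero_iff, or_iff_left hν.ne'] at hz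
  obtain rfl : m = 0 := WithLp.ofLp_injective 2 hm₀
  rw [← coords_ofCoords v, hv]
  ext i
  rcases i with _ | _ | _ <;> simp [coords, vech]

end Nondegeneracy

section FisherInformation

theorem dotProduct_covariance_mulVec {Ω ι : Type*} [Fintype ι] [MeasurableSpace Ω] {μ : Measure Ω}
    [IsFiniteMeasure μ] {Y : ι → Ω → ℝ} (hY : ∀ i, MemLp (Y i) 2 μ) (t : ι → ℝ) :
    t ⬝ᵥ (Matrix.of (fun i j => cov[Y i, Y j; μ]) *ᵥ t) = Var[fun ω => ∑ i, t i * Y i ω; μ] := by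
  rw [variance_fun_sum fun i => (hY i).const_mul (t i)]
  simp only [covariance_const_mul_left, covariance_const_mul_right, dotProduct, Matrix.mulVec,
    Matrix.of_apply, Finset.mul_sum]
  exact Finset.sum_congr rfl fun i _ => Finset.sum_congr rfl fun j _ => by ring

variable {k : ℕ} {V : Triple k}

theorem integrable_norm_scoreForm_sq (hV : V ∈ paramSpace k) :
    Integrable (fun x => ‖scoreForm (coords V) x‖ ^ 2) (law V) := by
  obtain ⟨b, w, r, C, h⟩ := exists_regularFamily (coords_mem_coordSpace hV)
  rw [law_eq_withLogDensity hV]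
  exact h.integrable_norm_score_pow h.mem_ball (by norm_num)

theorem integrable_scoreForm_apply_sq (hV : V ∈ paramSpace k) (t : EuclideanSpace ℝ (CoordIdx k)) :
    Integrable (fun x => scoreForm (coords V) x t ^ 2) (law V) := by
  have hcont := continuous_scoreForm (coords_mem_coordSpace hV)
  refine ((integrable_norm_scoreForm_sq hV).mul_const (‖t‖ ^ 2)).mono'
    (by fun_prop : Continuous _).aestronglyMeasurable (Eventually.of_forall fun x => ?_)
  rw [norm_pow, ← mul_pow]
  gcongr
  exact (scoreForm (coords V) x).le_opNorm t

theorem integral_scoreForm_apply (hV : V ∈ paramSpace k) (t : EuclideanSpace ℝ (CoordIdx k)) :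
    ∫ x, scoreForm (coords V) x t ∂law V = 0 := by
  obtain ⟨b, w, r, C, h⟩ := exists_regularFamily (coords_mem_coordSpace hV)
  rw [law_eq_withLogDensity hV, ← ContinuousLinearMap.integral_apply
    (h.integrable_score h.mem_ball), h.integral_score h.mem_ball, zero_apply]

theorem scoreForm_apply (hV : V ∈ paramSpace k) (x : EuclideanSpace ℝ (Fin k))
    (t : EuclideanSpace ℝ (CoordIdx k)) :
    scoreForm (coords V) x t = t.ofLp ⬝ᵥ (score V x).ofLp := by
  rw [← innerSL_score hV, innerSL_apply_apply, EuclideanSpace.inner_eq_star_dotProduct,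
    star_trivial]

theorem memLp_score (hV : V ∈ paramSpace k) (i : CoordIdx k) :
    MemLp (fun x => score V x i) 2 (law V) := by
  have hcont := continuous_score hV
  rw [memLp_two_iff_integrable_sq (by fun_prop : Continuous _).aestronglyMeasurable]
  simpa [scoreForm_apply hV] using
    integrable_scoreForm_apply_sq hV (EuclideanSpace.single i 1)

theorem dotProduct_fisherInfo_mulVec (hV : V ∈ paramSpace k)
    (t : EuclideanSpace ℝ (CoordIdx k)) :
    t.ofLp ⬝ᵥ (fisherInfo V *ᵥ t.ofLp) = ∫ x, scoreForm (coords V) x t ^ 2 ∂law V := by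
  have := isProbabilityMeasure_law hV
  have hcont := continuous_scoreForm (coords_mem_coordSpace hV)
  have hlin : (fun x => ∑ i, t i * score V x i) = fun x => scoreForm (coords V) x t :=
    funext fun x => (scoreForm_apply hV x t).symm
  rw [fisherInfo, dotProduct_covariance_mulVec (memLp_score hV), hlin,
    variance_of_integral_eq_zero (by fun_prop : Continuous _).aemeasurable
      (integral_scoreForm_apply hV t)]

theorem posSemidef_fisherInfo (hV : V ∈ paramSpace k) : (fisherInfo V).PosSemidef := by
  refine Matrix.posSemidef_iff_dotProduct_mulVec.2 ⟨?_, fun t => ?_⟩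
  · ext i j
    simp only [Matrix.conjTranspose_apply, star_trivial, fisherInfo, Matrix.of_apply,
      covariance_comm]
  · rw [star_trivial, dotProduct_fisherInfo_mulVec hV (WithLp.toLp 2 t)]
    exact integral_nonneg fun x => sq_nonneg _

theorem posDef_fisherInfo (hk : 0 < k) (hV : V ∈ paramSpace k) : (fisherInfo V).PosDef := by
  have hθ := coords_mem_coordSpace hV
  have hcont := continuous_scoreForm hθ
  refine Matrix.PosDef.of_dotProduct_mulVec_pos (posSemidef_fisherInfo hV).1 fun t ht => ?_
  rw [star_trivial, dotProduct_fisherInfo_mulVec hV (WithLp.toLp 2 t)]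
  refine (integral_nonneg fun x => sq_nonneg _).lt_of_ne' fun hzero => ht ?_
  have hae := (integral_eq_zero_iff_of_nonneg (fun x => sq_nonneg _)
    (integrable_scoreForm_apply_sq hV _)).1 hzero
  have hvol : (volume : Measure (EuclideanSpace ℝ (Fin k))) ≪ law V := by
    rw [law_eq_withLogDensity hV]
    exact absolutelyContinuous_withLogDensity (continuous_logDensity hθ).measurable
  have hsq := (((hcont.clm_apply continuous_const).pow 2).ae_eq_iff_eq volume
    continuous_const).1 (hvol.ae_le hae)
  exact congrArg WithLp.ofLp (eq_zero_of_forall_scoreForm_eq_zero hk hθ fun x =>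
    pow_eq_zero_iff two_ne_zero |>.1 (congrFun hsq x))

end FisherInformation

section LocalAsymptoticNormality

variable {k : ℕ} {V W : Triple k}

theorem lawN_eq_withLogDensity (hV : V ∈ paramSpace k) (hW : W ∈ paramSpace k) (n : ℕ) :
    lawN n W = withLogDensity (lawN n V)
      fun x => ∑ i, (logDensity (coords W) (x i) - logDensity (coords V) (x i)) := by
  have := isProbabilityMeasure_law hV
  have hmV := (continuous_logDensity (coords_mem_coordSpace hV)).measurable
  have hmW := (continuous_logDensity (coords_mem_coordSpace hW)).measurable
  have hlaw : law W = withLogDensity (law V)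
      fun x => logDensity (coords W) x - logDensity (coords V) x := by
    rw [law_eq_withLogDensity hV, law_eq_withLogDensity hW,
      withLogDensity_withLogDensity hmV (by fun_prop)]
    simp only [add_sub_cancel]
  simp only [lawN, hlaw]
  exact pi_withLogDensity _ fun _ => hmW.sub hmV

theorem lawN_absolutelyContinuous (hV : V ∈ paramSpace k) (hW : W ∈ paramSpace k) (n : ℕ) :
    lawN n W ≪ lawN n V := by
  rw [lawN_eq_withLogDensity hV hW]
  exact withLogDensity_absolutelyContinuous

theorem isProbabilityMeasure_lawN (hV : V ∈ paramSpace k) (n : ℕ) :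
    IsProbabilityMeasure (lawN n V) := by
  have := isProbabilityMeasure_law hV
  exact Measure.pi.instIsProbabilityMeasure _

theorem llr_lawN (hV : V ∈ paramSpace k) (hW : W ∈ paramSpace k) (n : ℕ) :
    llr (lawN n W) (lawN n V) =ᵐ[lawN n V]
      fun x => ∑ i, (logDensity (coords W) (x i) - logDensity (coords V) (x i)) := by
  have := isProbabilityMeasure_lawN hV n
  have hmV := (continuous_logDensity (coords_mem_coordSpace hV)).measurable
  have hmW := (continuous_logDensity (coords_mem_coordSpace hW)).measurable
  rw [lawN_eq_withLogDensity hV hW]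
  exact llr_withLogDensity (by fun_prop)

theorem dotProduct_centralSeq (hV : V ∈ paramSpace k) (n : ℕ)
    (x : Fin n → EuclideanSpace ℝ (Fin k)) (t : EuclideanSpace ℝ (CoordIdx k)) :
    t.ofLp ⬝ᵥ (centralSeq n V x).ofLp = (√(n : ℝ))⁻¹ * ∑ i, scoreForm (coords V) (x i) t := by
  simp only [scoreForm_apply hV, centralSeq, WithLp.ofLp_smul, WithLp.ofLp_sum, dotProduct_smul,
    dotProduct_sum, smul_eq_mul]

variable {Vn τ : ℕ → Triple k} {C : ℝ}

theorem tendstoInDistribution_centralSeq (hV : V ∈ paramSpace k) (hVn : ∀ n, Vn n ∈ paramSpace k)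
    (hlim : Tendsto (fun n => coords (Vn n)) atTop (𝓝 (coords V)))
    [∀ n, IsProbabilityMeasure (lawN n (Vn n))] :
    TendstoInDistribution (fun n => centralSeq n (Vn n)) atTop id (fun n => lawN n (Vn n))
      (multivariateGaussian 0 (fisherInfo V)) := by
  have := fun n => isProbabilityMeasure_law (hVn n)
  obtain ⟨b, w, r, C, h⟩ := exists_regularFamily (coords_mem_coordSpace hV)
  exact h.tendstoInDistribution_score hlim (fun n => law_eq_withLogDensity (hVn n))
    (fun n => (continuous_score (hVn n)).measurable) (fun n x => (innerSL_score (hVn n) x).symm)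
    (posSemidef_fisherInfo hV)
    fun t => by rw [dotProduct_fisherInfo_mulVec hV, law_eq_withLogDensity hV]

theorem isLittleOP_llr_sub (hV : V ∈ paramSpace k) (hVn : ∀ n, Vn n ∈ paramSpace k)
    (hlim : Tendsto (fun n => coords (Vn n)) atTop (𝓝 (coords V)))
    (hτ : ∀ n, ‖coords (τ n)‖ ≤ C) (hW : ∀ n, Vn n + (√(n : ℝ))⁻¹ • τ n ∈ paramSpace k) :
    IsLittleOP (fun n => lawN n (Vn n)) fun n X =>
      llr (lawN n (Vn n + (√(n : ℝ))⁻¹ • τ n)) (lawN n (Vn n)) X -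
        ((coords (τ n)).ofLp ⬝ᵥ (centralSeq n (Vn n) X).ofLp -
          1 / 2 * ((coords (τ n)).ofLp ⬝ᵥ (fisherInfo V *ᵥ (coords (τ n)).ofLp))) := by
  have := fun n => isProbabilityMeasure_law (hVn n)
  obtain ⟨b, w, r, C, h⟩ := exists_regularFamily (coords_mem_coordSpace hV)
  refine (h.isLittleOP_logLikelihood_sub hlim (fun n => law_eq_withLogDensity (hVn n)) hτ).of_abs_le
    (Eventually.of_forall fun n => ?_)
  filter_upwards [llr_lawN (hVn n) (hW n) n] with x hx
  rw [hx, dotProduct_centralSeq (hVn n), dotProduct_fisherInfo_mulVec hV,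
    law_eq_withLogDensity hV, coords_add_smul]

end LocalAsymptoticNormality

end StudentT

theorem theorem1_general (k : ℕ) (hk : 0 < k) (V : StudentT.Triple k)
    (hV : V ∈ StudentT.paramSpace k) :
    (∀ i, MemLp (fun x => StudentT.score V x i) 2 (StudentT.law V)) ∧
    (StudentT.fisherInfo V).PosDef ∧
    ∀ Vn : ℕ → StudentT.Triple k,
      (∀ n, Vn n ∈ StudentT.paramSpace k) →
      Tendsto (fun n => StudentT.coords (Vn n)) atTop (𝓝 (StudentT.coords V)) →
      (∃ _ : ∀ n, IsProbabilityMeasure (StudentT.lawN n (Vn n)),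
        TendstoInDistribution (fun n => StudentT.centralSeq n (Vn n)) atTop id
          (fun n => StudentT.lawN n (Vn n))
          (multivariateGaussian 0 (StudentT.fisherInfo V))) ∧
      ∀ τ : ℕ → StudentT.Triple k,
        (∃ C : ℝ, ∀ n, ‖StudentT.coords (τ n)‖ ≤ C) →
        (∀ n, Vn n + (√(n : ℝ))⁻¹ • τ n ∈ StudentT.paramSpace k) →
        (∀ n, StudentT.lawN n (Vn n + (√(n : ℝ))⁻¹ • τ n) ≪ StudentT.lawN n (Vn n)) ∧
        StudentT.IsLittleOP (fun n => StudentT.lawN n (Vn n)) fun n X =>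
          llr (StudentT.lawN n (Vn n + (√(n : ℝ))⁻¹ • τ n)) (StudentT.lawN n (Vn n)) X -
            ((StudentT.coords (τ n)).ofLp ⬝ᵥ (StudentT.centralSeq n (Vn n) X).ofLp -
              1 / 2 * ((StudentT.coords (τ n)).ofLp ⬝ᵥ
                (StudentT.fisherInfo V *ᵥ (StudentT.coords (τ n)).ofLp))) := by
  refine ⟨StudentT.memLp_score hV, StudentT.posDef_fisherInfo hk hV, fun Vn hVn hlim => ?_⟩
  have hprob (n : ℕ) := StudentT.isProbabilityMeasure_lawN (hVn n) n
  exact ⟨⟨hprob, StudentT.tendstoInDistribution_centralSeq hV hVn hlim⟩, fun τ ⟨C, hC⟩ hW =>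
    ⟨fun n => StudentT.lawN_absolutelyContinuous (hVn n) (hW n) n,
      StudentT.isLittleOP_llr_sub hV hVn hlim hC hW⟩⟩

theorem theorem1 (k : ℕ) (hk : 0 < k) (V : StudentT.Triple k) (hV : V ∈ StudentT.paramSpace k) :
    -- the Fisher information is finite, symmetric and non-singular
    (∀ i, MemLp (fun x => StudentT.score V x i) 2 (StudentT.law V)) ∧
    (StudentT.fisherInfo V).PosDef ∧
    ∀ Vn : ℕ → StudentT.Triple k,
      (∀ n, Vn n ∈ StudentT.paramSpace k) →
      (fun n => StudentT.coords (Vn n) - StudentT.coords V)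
        =O[atTop] (fun n : ℕ => (√(n : ℝ))⁻¹) →
      -- asymptotic normality of the central sequence
      (∃ _ : ∀ n, IsProbabilityMeasure (StudentT.lawN n (Vn n)),
        TendstoInDistribution (fun n => StudentT.centralSeq n (Vn n)) atTop id
          (fun n => StudentT.lawN n (Vn n))
          (multivariateGaussian 0 (StudentT.fisherInfo V))) ∧
      -- expansion of the log-likelihood ratio
      ∀ τ : ℕ → StudentT.Triple k,
        (∃ C : ℝ, ∀ n, ‖StudentT.coords (τ n)‖ ≤ C) →
        (∀ n, Vn n + (√(n : ℝ))⁻¹ • τ n ∈ StudentT.paramSpace k) →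
        (∀ n, StudentT.lawN n (Vn n + (√(n : ℝ))⁻¹ • τ n) ≪ StudentT.lawN n (Vn n)) ∧
        StudentT.IsLittleOP (fun n => StudentT.lawN n (Vn n)) fun n X =>
          llr (StudentT.lawN n (Vn n + (√(n : ℝ))⁻¹ • τ n)) (StudentT.lawN n (Vn n)) X -
            ((StudentT.coords (τ n)).ofLp ⬝ᵥ (StudentT.centralSeq n (Vn n) X).ofLp -
              1 / 2 * ((StudentT.coords (τ n)).ofLp ⬝ᵥ
                (StudentT.fisherInfo V *ᵥ (StudentT.coords (τ n)).ofLp))) := by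
  obtain ⟨hscore, hinfo, hulan⟩ := theorem1_general k hk V hV
  exact ⟨hscore, hinfo, fun Vn hVn hO => hulan Vn hVn (tendsto_sub_nhds_zero_iff.1
    (hO.trans_tendsto StudentT.tendsto_inv_sqrt_natCast))⟩
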